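/- All graphs are finite, simple and undirected. For a graph $G$, let $T(G)$ be the family of all sets $\{e_1,e_2,e_3\}$ consisting of the edges of a triangle of $G$. Let $\rho^{K_3}(G)$ be the maximum number of pairwise disjoint members of $T(G)$ (that is, of pairwise edge-disjoint triangles in $G$), and let $\rho_f^{K_3}(G)$ be the maximum of $\sum_{t\in T(G)}x_t$ over all real $x_t\ge 0$ such that $\sum_{t\in T(G),\,t\ni e}x_t\le 1$ for every edge $e$ of $G$. Call graphs $G$ and $H$ $\mathrm{WL}_2$-equivalent if they have the same number $n$ of vertices and, after $n^2$ rounds of the 2-dimensional Weisfeiler–Leman procedure, the same multiset of colors of pairs of vertices. Here the initial color of $(x,y)$ is its ordered isomorphism type (whether $x=y$, $xy$ is an edge, or neither), and in each round the color $c(x,y)$ is replaced by the pair consisting of $c(x,y)$ and the multiset of the pairs $(c(u,y),c(x,u))$ over all vertices $u$. **Theorem.** The integrality gap $$\mathit{IG}^{K_3}=\sup_{G}\frac{\rho_f^{K_3}(G)}{\rho^{K_3}(G)},$$ where $G$ ranges over all graphs containing at least one triangle, and the $\mathrm{WL}_2$-invariance ratio $$\mathit{IR}^{K_3}=\sup_{G,H}\left|\frac{\rho^{K_3}(G)}{\rho^{K_3}(H)}\right|,$$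 where $(G,H)$ ranges over all pairs of $\mathrm{WL}_2$-equivalent graphs that both contain at least one triangle, satisfy $$\mathit{IG}^{K_3}=\mathit{IR}^{K_3}=2.$$ Moreover, let $S$ be the Shrikhande graph, on $\mathbb{Z}_4\times\mathbb{Z}_4$ with two vertices adjacent if their difference is one of $\pm(0,1),\pm(1,0),\pm(1,1)$, and let $R$ be the $4\times4$ rook's graph, on $\mathbb{Z}_4\times\mathbb{Z}_4$ with two distinct vertices adjacent if they agree in one coordinate. Then $S$ and $R$ are $\mathrm{WL}_2$-equivalent, $\rho^{K_3}(S)=16$ and $\rho^{K_3}(R)=8$. -/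

import Mathlib

namespace TrianglePacking

noncomputable section

/-! ### Matching number and fractional matching number of a set family -/

open Classical in
/-- The matching number `ν(𝒮)`: the maximum number of pairwise disjoint members of `𝒮`. -/
def matchingNumber {E : Type} (S : Finset (Finset E)) : ℕ :=
  (S.powerset.filter fun P : Finset (Finset E) => (P : Set (Finset E)).PairwiseDisjoint id).sup Finset.card

open Classical in
/-- Feasible solutions of the linear program: nonnegative weights on the members of `S` such that
the members containing any given point have total weight at most `1`. -/
def IsFractionalMatching {E : Type} (S : Finset (Finset E)) (x : Finset E → ℝ) : Prop :=
  (∀ s ∈ S, 0 ≤ x s) ∧ ∀ j : E, ∑ s ∈ S.filter (fun s => j ∈ s), x s ≤ 1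

/-- The fractional matching number `ν_f(𝒮)`: the optimum value of the linear program
(the program is feasible, and it is bounded when all members of `S` are nonempty). -/
def fractionalMatchingNumber {E : Type} (S : Finset (Finset E)) : ℝ :=
  sSup {r : ℝ | ∃ x : Finset E → ℝ, IsFractionalMatching S x ∧ r = ∑ s ∈ S, x s}

/-! ### Edge-disjoint triangle packing -/

open Classical in
/-- The family `T(G)` of all sets `{e₁, e₂, e₃}` that consist of the edges of a triangle of `G`. -/
def triangleFamily {V : Type} [Fintype V] (G : SimpleGraph V) : Finset (Finset (Sym2 V)) :=
  Finset.univ.filter fun t => ∃ a b c : V, G.Adj a b ∧ G.Adj b c ∧ G.Adj a c ∧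
    t = {s(a, b), s(b, c), s(a, c)}

/-- The edge-disjoint triangle packing number of `G`. -/
def rho {V : Type} [Fintype V] (G : SimpleGraph V) : ℕ :=
  matchingNumber (triangleFamily G)

/-- The fractional edge-disjoint triangle packing number of `G`. -/
def rhoFrac {V : Type} [Fintype V] (G : SimpleGraph V) : ℝ :=
  fractionalMatchingNumber (triangleFamily G)

/-- The linear program that defines `rhoFrac G` is feasible and bounded, so that its value is a
genuine supremum. -/
theorem rhoFrac_program {V : Type} [Fintype V] (G : SimpleGraph V) :
    {r : ℝ | ∃ x, IsFractionalMatching (triangleFamily G) x ∧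
      r = ∑ s ∈ triangleFamily G, x s}.Nonempty ∧
    BddAbove {r : ℝ | ∃ x, IsFractionalMatching (triangleFamily G) x ∧
      r = ∑ s ∈ triangleFamily G, x s} := by
  classical
  refine ⟨⟨0, fun _ => 0, ⟨by simp, by simp⟩, by simp⟩, (triangleFamily G).card, ?_⟩
  rintro r ⟨x, ⟨h0, h1⟩, rfl⟩
  have key : ∀ s ∈ triangleFamily G, x s ≤ 1 := by
    intro s hs
    have hs' := hs
    obtain ⟨a, b, c, -, -, -, ht⟩ := (Finset.mem_filter.mp hs').2
    have ha : s(a, b) ∈ s := by rw [ht]; simp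
    refine le_trans ?_ (h1 s(a, b))
    convert Finset.single_le_sum (f := x) (s := (triangleFamily G).filter (fun s' => s(a, b) ∈ s'))
      (fun i hi => h0 i (Finset.mem_filter.mp hi).1) (Finset.mem_filter.mpr ⟨hs, ha⟩)
  calc ∑ s ∈ triangleFamily G, x s ≤ ∑ s ∈ triangleFamily G, (1 : ℝ) := Finset.sum_le_sum key
    _ = (triangleFamily G).card := by simp

/-! ### The 2-dimensional Weisfeiler-Leman procedure -/

/-- The colors that can occur in round `r`. A color of round `r + 1` is a color of round `r`
together with a multiset of pairs of colors of round `r`; so colors of different graphs can be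
compared. -/
def WL2Color : ℕ → Type
  | 0 => Matrix (Fin 2) (Fin 2) ℕ
  | r + 1 => WL2Color r × Multiset (WL2Color r × WL2Color r)

open Classical in
/-- The entry of the initial color: `1` for adjacent, `2` for equal, and `0` otherwise. -/
def atomicType {V : Type} (G : SimpleGraph V) (x y : V) : ℕ :=
  if G.Adj x y then 1 else if x = y then 2 else 0

/-- The color of the pair `(x, y)` of vertices of `G` after `r` refinement rounds. -/
def wl2 {V : Type} [Fintype V] (G : SimpleGraph V) : (r : ℕ) → V → V → WL2Color r
  | 0, x, y => Matrix.of fun i j => atomicType G (![x, y] i) (![x, y] j)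
  | r + 1, x, y =>
      (wl2 G r x y, (Finset.univ : Finset V).val.map fun u => (wl2 G r u y, wl2 G r x u))

/-- The multiset of the colors of all pairs of vertices of `G` after `r` rounds. -/
def wl2Palette {V : Type} [Fintype V] (G : SimpleGraph V) (r : ℕ) : Multiset (WL2Color r) :=
  (Finset.univ : Finset (V × V)).val.map fun p => wl2 G r p.1 p.2

/-- `WL₂`-equivalence: after `n ^ 2` rounds, where `n` is the number of vertices, the two graphs
have the same multiset of colors. (Graphs with different numbers of vertices are not equivalent,
because their multisets have different sizes.) -/
def WL2Equiv {V W : Type} [Fintype V] [Fintype W] (G : SimpleGraph V) (H : SimpleGraph W) : Prop :=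
  Fintype.card V = Fintype.card W ∧
    wl2Palette G (Fintype.card V ^ 2) = wl2Palette H (Fintype.card V ^ 2)

/-! ### Integrality gap and invariance ratio -/

/-- The integrality gap: the supremum, in the extended reals, of `ρ_f(G) / ρ(G)` over all finite
graphs `G` that contain a triangle. -/
def integralityGap : EReal :=
  sSup {q : EReal | ∃ (V : Type) (_ : Fintype V) (G : SimpleGraph V),
    ¬ G.CliqueFree 3 ∧ q = ((rhoFrac G / (rho G : ℝ) : ℝ) : EReal)}

/-- The `WL₂`-invariance ratio: the supremum, in the extended reals, of `ρ(G) / ρ(H)` over all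
pairs of `WL₂`-equivalent finite graphs `G` and `H` that contain a triangle. -/
def invarianceRatio : EReal :=
  sSup {q : EReal | ∃ (V W : Type) (_ : Fintype V) (_ : Fintype W)
    (G : SimpleGraph V) (H : SimpleGraph W),
    ¬ G.CliqueFree 3 ∧ ¬ H.CliqueFree 3 ∧ WL2Equiv G H ∧
      q = (|(rho G : ℝ) / (rho H : ℝ)| : ℝ)}

/-! ### Two graphs on `ℤ/4 × ℤ/4` -/

/-- The Shrikhande graph. (`SimpleGraph.fromRel` symmetrizes the relation and removes loops.) -/
def shrikhande : SimpleGraph (ZMod 4 × ZMod 4) :=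
  SimpleGraph.fromRel fun p q =>
    (p.1 = q.1 ∧ q.2 = p.2 + 1) ∨ (p.2 = q.2 ∧ q.1 = p.1 + 1) ∨
      (q.1 = p.1 + 1 ∧ q.2 = p.2 + 1)

/-- The `4 × 4` rook's graph. -/
def rook : SimpleGraph (ZMod 4 × ZMod 4) :=
  SimpleGraph.fromRel fun p q => p.1 = q.1 ∨ p.2 = q.2

end

end TrianglePacking

namespace TrianglePacking

open Classical

/-! ### Matchings and fractional matchings of families of triples -/

/-! Everything rests on the chain `rho G ≤ rhoFrac G = rhoFrac H ≤ 2 * rho H` for equivalent `G` and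
`H`, together with one extremal pair: since `rho shrikhande = 16` and `rho rook = 8`, the pair
attains the ratio 2, and `rhoFrac rook = rhoFrac shrikhande ≥ 16` attains the gap 2.

The last inequality (`rhoFrac_le_two_mul_rho`) is an induction over subfamilies `F` of the
triangles. A member of weight 0 is dropped; a member of weight at least 1/2 is put into the matching
and everything meeting it, of weight at most 2, is removed. Otherwise the weighting is pushed along
directions vanishing at the tight edges, until no such direction is left. Then there are at least as
many tight edges as triangles, while each tight edge lies in at least three triangles, all weights
being below 1/2; double counting makes `F` 3-regular. In a 3-regular family the link of a vertex has
minimum degree 3 on its non-isolated vertices, so it contains an even cycle, and every other edge of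
that cycle gives `k` disjoint triangles meeting at most `6 * k` members, of weight `2 * k` when all
weights are 1/3.

The equality (`WL2Equiv.rhoFrac_eq`) comes from averaging: at a round where the coloring is stable
on both graphs, a fractional packing of `H` is averaged over all ordered triples with the same three
pair colors. The averages are read as weights on the triples of `G`; stability preserves the edge
constraints, equality of palettes the total. -/

theorem card_le_matchingNumber {E : Type} {S P : Finset (Finset E)} (hP : P ⊆ S)
    (hd : (P : Set (Finset E)).PairwiseDisjoint id) : P.card ≤ matchingNumber S := by
  unfold matchingNumber
  exact Finset.le_sup (f := Finset.card)
    (Finset.mem_filter.mpr ⟨Finset.mem_powerset.mpr hP, hd⟩)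

theorem matchingNumber_le {E : Type} {S : Finset (Finset E)} {n : ℕ}
    (h : ∀ P ⊆ S, (P : Set (Finset E)).PairwiseDisjoint id → P.card ≤ n) :
    matchingNumber S ≤ n := by
  unfold matchingNumber
  refine Finset.sup_le fun P hP => ?_
  rw [Finset.mem_filter, Finset.mem_powerset] at hP
  exact h P hP.1 hP.2

theorem exists_card_eq_matchingNumber {E : Type} (S : Finset (Finset E)) :
    ∃ P ⊆ S, (P : Set (Finset E)).PairwiseDisjoint id ∧ P.card = matchingNumber S := by
  have hne : (S.powerset.filter
      fun P : Finset (Finset E) => (P : Set (Finset E)).PairwiseDisjoint id).Nonempty :=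
    ⟨∅, by simp⟩
  obtain ⟨P, hP, h⟩ := Finset.exists_mem_eq_sup _ hne Finset.card
  rw [Finset.mem_filter, Finset.mem_powerset] at hP
  exact ⟨P, hP.1, hP.2, by unfold matchingNumber; exact h.symm⟩

theorem matchingNumber_mono {E : Type} {S T : Finset (Finset E)} (h : S ⊆ T) :
    matchingNumber S ≤ matchingNumber T :=
  matchingNumber_le fun _ hP hd => card_le_matchingNumber (hP.trans h) hd

/-- `P` extends any matching of `F'`. Nonemptiness is needed because the empty set is disjoint from
itself and could be counted twice. -/
theorem card_add_matchingNumber_le {E : Type} {F F' P : Finset (Finset E)} (hP : P ⊆ F)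
    (hF' : F' ⊆ F) (hd : (P : Set (Finset E)).PairwiseDisjoint id) (hne : ∀ f ∈ F, f.Nonempty)
    (hdisj : ∀ f ∈ F', ∀ p ∈ P, Disjoint f p) :
    P.card + matchingNumber F' ≤ matchingNumber F := by
  obtain ⟨Q, hQ, hQd, hQc⟩ := exists_card_eq_matchingNumber F'
  have hPQ : Disjoint P Q := by
    rw [Finset.disjoint_left]
    intro p hp hq
    have h := hdisj p (hQ hq) p hp
    rw [disjoint_self] at h
    exact (hne p (hP hp)).ne_empty h
  rw [← hQc, ← Finset.card_union_of_disjoint hPQ]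
  refine card_le_matchingNumber (Finset.union_subset hP (hQ.trans hF')) ?_
  rw [Finset.coe_union, Set.pairwiseDisjoint_union]
  exact ⟨hd, hQd, fun p hp q hq _ => (hdisj q (hQ hq) p hp).symm⟩

/-- The total weight of the members of `F` that contain `x`. -/
noncomputable def load {E : Type} (F : Finset (Finset E)) (w : Finset E → ℝ) (x : E) : ℝ :=
  ∑ s ∈ F.filter (fun s => x ∈ s), w s

theorem isFractionalMatching_iff {E : Type} {F : Finset (Finset E)} {w : Finset E → ℝ} :
    IsFractionalMatching F w ↔ (∀ s ∈ F, 0 ≤ w s) ∧ ∀ x, load F w x ≤ 1 := Iff.rfl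

theorem IsFractionalMatching.subset {E : Type} {F F' : Finset (Finset E)} {w : Finset E → ℝ}
    (h : IsFractionalMatching F w) (hF : F' ⊆ F) : IsFractionalMatching F' w := by
  refine ⟨fun s hs => h.1 s (hF hs), fun x => le_trans ?_ (h.2 x)⟩
  exact Finset.sum_le_sum_of_subset_of_nonneg (Finset.filter_subset_filter _ hF)
    fun i hi _ => h.1 i (Finset.mem_filter.mp hi).1

theorem load_add_smul {E : Type} (F : Finset (Finset E)) (w z : Finset E → ℝ) (s : ℝ) (x : E) :
    load F (fun f => w f + s * z f) x = load F w x + s * load F z x := by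
  simp only [load, Finset.sum_add_distrib, Finset.mul_sum]

/-- Double counting of the incidences between a point set and a family. -/
theorem sum_load {E : Type} [Fintype E] (F : Finset (Finset E)) (w : Finset E → ℝ) :
    ∑ x, load F w x = ∑ f ∈ F, f.card * w f := by
  simp only [load, Finset.sum_filter]
  rw [Finset.sum_comm]
  refine Finset.sum_congr rfl fun f _ => ?_
  rw [← Finset.sum_filter]
  simp

/-- The loads at the three points of `e` add up to at most 3. This sum counts `e` three times and
every other member meeting `e` at least once; the two extra copies of `w e` have weight at least 1.
-/
theorem sum_inter_le_of_half_le {E : Type} {F : Finset (Finset E)} {w : Finset E → ℝ}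
    (hw : IsFractionalMatching F w) {e : Finset E} (he : e ∈ F) (hc : e.card = 3)
    (h : 1 / 2 ≤ w e) : ∑ f ∈ F.filter (fun f => ¬ Disjoint f e), w f ≤ 2 := by
  have h1 : ∑ x ∈ e, load F w x = ∑ f ∈ F, ((e ∩ f).card : ℝ) * w f := by
    simp only [load, Finset.sum_filter]
    rw [Finset.sum_comm]
    refine Finset.sum_congr rfl fun f _ => ?_
    rw [← Finset.sum_filter, Finset.filter_mem_eq_inter]
    simp
  have h2 : ∑ x ∈ e, load F w x ≤ 3 := by
    calc ∑ x ∈ e, load F w x ≤ ∑ x ∈ e, (1 : ℝ) := Finset.sum_le_sum fun x _ => hw.2 x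
      _ = 3 := by simp [hc]
  have h3 : ∑ f ∈ F, ((if ¬ Disjoint f e then w f else 0) + if f = e then 2 * w f else 0) ≤
      ∑ f ∈ F, ((e ∩ f).card : ℝ) * w f := by
    refine Finset.sum_le_sum fun f hf => ?_
    have h0 := hw.1 f hf
    by_cases hfe : f = e
    · subst hfe
      have hne : f ≠ ∅ := by rintro rfl; simp at hc
      rw [if_pos (by simpa using hne), if_pos rfl, Finset.inter_self, hc]
      push_cast
      linarith
    · rw [if_neg hfe, add_zero]
      by_cases hd : Disjoint f e
      · rw [if_neg (not_not.mpr hd)]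
        positivity
      · rw [if_pos hd]
        have : 1 ≤ (e ∩ f).card := by
          rw [Nat.one_le_iff_ne_zero, Finset.card_ne_zero, ← Finset.not_disjoint_iff_nonempty_inter]
          exact fun h => hd h.symm
        have : (1 : ℝ) ≤ (e ∩ f).card := by exact_mod_cast this
        nlinarith
  rw [Finset.sum_add_distrib, ← Finset.sum_filter, Finset.sum_ite_eq' F e, if_pos he] at h3
  linarith

/-- A fractional matching can be pushed along a direction that vanishes at the tight points,
without lowering its value, until a new constraint becomes tight. -/
theorem IsFractionalMatching.exists_push {E : Type} [Fintype E] {F : Finset (Finset E)}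
    {w z : Finset E → ℝ} (hw : IsFractionalMatching F w) (hne : ∀ f ∈ F, f.Nonempty)
    (hz : ∃ f ∈ F, z f ≠ 0) (hz0 : ∀ x, load F w x = 1 → load F z x = 0) :
    ∃ w', IsFractionalMatching F w' ∧ ∑ f ∈ F, w f ≤ ∑ f ∈ F, w' f ∧
      (∀ x, load F w x = 1 → load F w' x = 1) ∧
      ((∃ f ∈ F, w' f = 0) ∨ ∃ x, load F w x ≠ 1 ∧ load F w' x = 1) := by
  -- The hypotheses on `z` are invariant under negation, so the direction may be chosen not to lower
  -- the value.
  wlog hs : 0 ≤ ∑ f ∈ F, z f generalizing z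
  · have hneg : ∀ x, load F (fun f => - z f) x = - load F z x := fun x => by simp [load]
    exact this (z := fun f => - z f) (by simpa using hz)
      (fun x hx => by rw [hneg, hz0 x hx, neg_zero])
      (by rw [Finset.sum_neg_distrib]; linarith)
  obtain ⟨g, hg, hgz⟩ : ∃ f ∈ F, 0 < z f := by
    by_contra! hcon
    obtain ⟨f, hf, hf0⟩ := hz
    have : ∑ f ∈ F, z f < 0 := Finset.sum_neg' hcon ⟨f, hf, lt_of_le_of_ne (hcon f hf) hf0⟩
    linarith
  -- `S` is the set of feasible step lengths: closed, and bounded because some member has positive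
  -- slope. The step taken is its maximum.
  let S : Set ℝ := {s | 0 ≤ s ∧ IsFractionalMatching F fun f => w f + s * z f}
  have hS : S = {s | 0 ≤ s} ∩ ((⋂ f ∈ F, {s | 0 ≤ w f + s * z f}) ∩
      ⋂ x, {s | load F w x + s * load F z x ≤ 1}) := by
    ext s
    simp [S, isFractionalMatching_iff, load_add_smul]
  have hclosed : IsClosed S := by
    rw [hS]
    refine (isClosed_le (by fun_prop) (by fun_prop)).inter (IsClosed.inter ?_ ?_)
    · exact isClosed_biInter fun f _ => isClosed_le (by fun_prop) (by fun_prop)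
    · exact isClosed_iInter fun f => isClosed_le (by fun_prop) (by fun_prop)
  have hbdd : BddAbove S := by
    refine ⟨1 / z g, fun s ⟨_, h1, h2⟩ => ?_⟩
    obtain ⟨x, hx⟩ := hne g hg
    have h3 : w g + s * z g ≤ 1 :=
      (Finset.single_le_sum (f := fun f => w f + s * z f)
        (fun i hi => h1 i (Finset.mem_filter.mp hi).1)
        (Finset.mem_filter.mpr ⟨hg, hx⟩)).trans (h2 x)
    rw [le_div_iff₀ hgz]
    linarith [hw.1 g hg]
  have h0 : (0 : ℝ) ∈ S := ⟨le_rfl, by simpa using hw⟩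
  obtain ⟨hs0, hfeas⟩ : sSup S ∈ S := hclosed.csSup_mem ⟨0, h0⟩ hbdd
  set s := sSup S with hsdef
  refine ⟨_, hfeas, ?_, ?_, ?_⟩
  · rw [Finset.sum_add_distrib, ← Finset.mul_sum]
    nlinarith
  · intro x hx
    rw [load_add_smul, hz0 x hx, hx, mul_zero, add_zero]
  · by_contra! hcon
    -- With all weights positive and no new tight point, every constraint not constant along `z` is
    -- strict, so a slightly longer step is feasible, against maximality.
    obtain ⟨hpos, hlt⟩ := hcon
    have e1 : ∀ᶠ t in nhds s, ∀ f ∈ F, 0 ≤ w f + t * z f := by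
      rw [Filter.eventually_all_finset]
      intro f hf
      have hc : Continuous fun t : ℝ => w f + t * z f := by fun_prop
      have : 0 < w f + s * z f := lt_of_le_of_ne (hfeas.1 f hf) (hpos f hf).symm
      exact (hc.continuousAt.eventually (lt_mem_nhds this)).mono fun t ht => ht.le
    have e2 : ∀ᶠ t in nhds s, ∀ x, load F w x + t * load F z x ≤ 1 := by
      rw [Filter.eventually_all]
      intro x
      by_cases hx : load F w x = 1
      · exact Filter.Eventually.of_forall fun t => by rw [hz0 x hx, hx]; simp
      · have hc : Continuous fun t : ℝ => load F w x + t * load F z x := by fun_prop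
        have : load F w x + s * load F z x < 1 := by
          refine lt_of_le_of_ne ?_ ?_
          · rw [← load_add_smul]; exact hfeas.2 x
          · rw [← load_add_smul]; exact hlt x hx
        exact (hc.continuousAt.eventually (gt_mem_nhds this)).mono fun t ht => ht.le
    obtain ⟨t, ⟨ht1, ht2⟩, ht3⟩ :=
      (((e1.and e2).filter_mono nhdsWithin_le_nhds).and
        (self_mem_nhdsWithin (s := Set.Ioi s))).exists
    have ht : t ∈ S := ⟨hs0.trans (le_of_lt ht3), ht1, fun x => by
      have := ht2 x; rwa [← load_add_smul] at this⟩
    exact absurd (le_csSup hbdd ht) (not_le.mpr ht3)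

/-- If no nonzero direction vanishes at all points of `X`, there are at least as many points in `X`
as members of the family. -/
theorem card_le_card_of_load_injective {E : Type} (F : Finset (Finset E)) (X : Finset E)
    (h : ∀ z : Finset E → ℝ, (∀ x ∈ X, load F z x = 0) → ∀ f ∈ F, z f = 0) :
    F.card ≤ X.card := by
  let ext (z : F → ℝ) : Finset E → ℝ := fun f => if hf : f ∈ F then z ⟨f, hf⟩ else 0
  -- The incidence map from weights to loads on `X` is injective; compare dimensions.
  let A : (F → ℝ) →ₗ[ℝ] (X → ℝ) :=
    { toFun := fun z x => load F (ext z) x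
      map_add' := fun z z' => by
        ext x
        simp only [load, Pi.add_apply, ← Finset.sum_add_distrib]
        refine Finset.sum_congr rfl fun f hf => ?_
        simp [ext, (Finset.mem_filter.mp hf).1]
      map_smul' := fun c z => by
        ext x
        simp only [load, Pi.smul_apply, Finset.smul_sum, RingHom.id_apply]
        refine Finset.sum_congr rfl fun f hf => ?_
        simp [ext, (Finset.mem_filter.mp hf).1] }
  have hA : Function.Injective A := by
    rw [← LinearMap.ker_eq_bot, LinearMap.ker_eq_bot']
    intro z hz
    ext ⟨f, hf⟩
    have := h (ext z) (fun x hx => congrFun hz ⟨x, hx⟩) f hf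
    simpa [ext, hf] using this
  simpa using LinearMap.finrank_le_finrank_of_injective hA

/-- A fractional matching of a family of triples has value at most `2 ν`, provided that every
nonempty `3`-regular subfamily has a nonempty matching that meets on average at most six
members per triple. -/
theorem IsFractionalMatching.sum_le_two_mul_matchingNumber {E : Type} [Fintype E]
    {T : Finset (Finset E)} (hcard : ∀ f ∈ T, f.card = 3)
    (hreg : ∀ F ⊆ T, F.Nonempty →
      (∀ x, (F.filter fun f => x ∈ f).card = 0 ∨ (F.filter fun f => x ∈ f).card = 3) →
      ∃ P ⊆ F, P.Nonempty ∧ (P : Set (Finset E)).PairwiseDisjoint id ∧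
        (F.filter fun f => ¬ ∀ p ∈ P, Disjoint f p).card ≤ 6 * P.card) :
    ∀ F ⊆ T, ∀ w, IsFractionalMatching F w → ∑ f ∈ F, w f ≤ 2 * matchingNumber F := by
  intro F
  induction F using Finset.strongInduction with
  | H F ih =>
  intro hF w hw
  have hne : ∀ f ∈ F, f.Nonempty := fun f hf =>
    Finset.card_pos.mp (by rw [hcard f (hF hf)]; norm_num)
  -- Removing `P` and all members that meet it costs weight at most `2 * P.card` and lowers the
  -- matching number by at least `P.card`.
  have delete : ∀ P ⊆ F, P.Nonempty → (P : Set (Finset E)).PairwiseDisjoint id →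
      ∀ w, IsFractionalMatching F w →
      ∑ f ∈ F.filter (fun f => ¬ ∀ p ∈ P, Disjoint f p), w f ≤ 2 * P.card →
      ∑ f ∈ F, w f ≤ 2 * matchingNumber F := by
    intro P hP hPne hPd w hw hsum
    have hsub : F.filter (fun f => ∀ p ∈ P, Disjoint f p) ⊂ F := by
      obtain ⟨p, hp⟩ := hPne
      refine Finset.filter_ssubset.mpr ⟨p, hP hp, fun h => ?_⟩
      have := h p hp
      rw [disjoint_self] at this
      exact (hne p (hP hp)).ne_empty this
    have h1 := ih _ hsub (hsub.subset.trans hF) w (hw.subset hsub.subset)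
    have h2 := card_add_matchingNumber_le hP hsub.subset hPd hne
      fun f hf => (Finset.mem_filter.mp hf).2
    rw [← Nat.cast_le (α := ℝ), Nat.cast_add] at h2
    have h3 := Finset.sum_filter_add_sum_filter_not F (fun f => ∀ p ∈ P, Disjoint f p) w
    linarith
  have erase : ∀ w, IsFractionalMatching F w → (∃ f ∈ F, w f = 0) →
      ∑ f ∈ F, w f ≤ 2 * matchingNumber F := by
    rintro w hw ⟨f, hf, hf0⟩
    have h1 := ih _ (Finset.erase_ssubset hf) ((Finset.erase_subset f F).trans hF) w
      (hw.subset (Finset.erase_subset f F))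
    have h2 : (matchingNumber (F.erase f) : ℝ) ≤ matchingNumber F := by
      exact_mod_cast matchingNumber_mono (Finset.erase_subset f F)
    rw [← Finset.add_sum_erase F w hf, hf0]
    linarith
  -- For fixed `F`, an inner induction on the number of points that are not tight controls the
  -- pushes.
  induction hn : (Finset.univ.filter fun x => load F w x ≠ 1).card using
    Nat.strong_induction_on generalizing w with
  | _ n ihn =>
  subst hn
  rcases F.eq_empty_or_nonempty with rfl | hFne
  · simp
  by_cases hzero : ∃ f ∈ F, w f = 0
  · exact erase w hw hzero
  by_cases hheavy : ∃ e ∈ F, 1 / 2 ≤ w e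
  · obtain ⟨e, he, hhalf⟩ := hheavy
    refine delete {e} (by simpa using he) (by simp) (by simp) w hw ?_
    have := sum_inter_le_of_half_le hw he (hcard e (hF he)) hhalf
    simpa using this
  by_cases hdir : ∃ z : Finset E → ℝ, (∃ f ∈ F, z f ≠ 0) ∧ ∀ x, load F w x = 1 → load F z x = 0
  · obtain ⟨z, hz, hz0⟩ := hdir
    obtain ⟨w', hw', hle, htight, hnew⟩ := hw.exists_push hne hz hz0
    refine hle.trans ?_
    rcases hnew with hnew | ⟨x, hx, hx'⟩
    · exact erase w' hw' hnew
    · refine ihn _ (Finset.card_lt_card ?_) w' hw' rfl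
      rw [Finset.ssubset_iff_of_subset
        (Finset.monotone_filter_right _ fun y _ hy => mt (htight y) hy)]
      exact ⟨x, by simpa using hx, by simpa using hx'⟩
  push Not at hzero hheavy hdir
  set X := Finset.univ.filter fun x => load F w x = 1 with hX
  have hFX : F.card ≤ X.card := by
    refine card_le_card_of_load_injective F X fun z hz => ?_
    by_contra! hcon
    obtain ⟨x, hx, hx0⟩ := hdir z hcon
    exact hx0 (hz x (by simpa [hX] using hx))
  set d : E → ℕ := fun x => (F.filter fun f => x ∈ f).card with hd
  have hdX : ∀ x ∈ X, 3 ≤ d x := by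
    intro x hx
    have hx1 : load F w x = 1 := by simpa [hX] using hx
    by_contra! hlt
    have hne' : (F.filter fun f => x ∈ f).Nonempty := by
      rw [Finset.nonempty_iff_ne_empty]
      intro h0
      simp [load, h0] at hx1
    have h1 : load F w x < ∑ f ∈ F.filter (fun f => x ∈ f), (1 / 2 : ℝ) :=
      Finset.sum_lt_sum_of_nonempty hne' fun f hf => hheavy f (Finset.mem_filter.mp hf).1
    rw [hx1, Finset.sum_const, nsmul_eq_mul] at h1
    have h2 : (d x : ℝ) ≤ 2 := by exact_mod_cast Nat.lt_succ_iff.mp hlt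
    have h3 : (1 : ℝ) < d x * (1 / 2) := h1
    linarith
  have hsum : ∑ x, d x = 3 * F.card := by
    have h := sum_load F fun _ => 1
    have h' : ∑ f ∈ F, (f.card : ℝ) * 1 = ∑ f ∈ F, (3 : ℝ) :=
      Finset.sum_congr rfl fun f hf => by rw [hcard f (hF hf)]; norm_num
    rw [h'] at h
    simp only [load, Finset.sum_const, nsmul_eq_mul, mul_one] at h
    have h2 : ((∑ x, d x : ℕ) : ℝ) = ((3 * F.card : ℕ) : ℝ) := by
      push_cast
      rw [h]
      ring
    exact_mod_cast h2
  -- Now `3 * X.card ≤ ∑ x, d x = 3 * F.card ≤ 3 * X.card`, so equality holds throughout: degree 3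
  -- on `X` and degree 0 elsewhere.
  have hsplit : ∑ x, d x = ∑ x ∈ X, d x + ∑ x ∈ Xᶜ, d x := (Finset.sum_add_sum_compl X d).symm
  have hXsum : X.card * 3 ≤ ∑ x ∈ X, d x := by
    simpa using Finset.card_nsmul_le_sum X d 3 hdX
  have hXc : ∑ x ∈ Xᶜ, d x = 0 := by omega
  have hXe : ∑ x ∈ X, d x = ∑ x ∈ X, 3 := by
    rw [Finset.sum_const, smul_eq_mul]
    omega
  have hdeg : ∀ x, d x = 0 ∨ d x = 3 := by
    intro x
    by_cases hx : x ∈ X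
    · exact Or.inr ((Finset.sum_eq_sum_iff_of_le hdX).mp hXe.symm x hx).symm
    · exact Or.inl (Finset.sum_eq_zero_iff.mp hXc x (Finset.mem_compl.mpr hx))
  obtain ⟨P, hP, hPne, hPd, hP6⟩ := hreg F hF hFne hdeg
  -- The bound on `P` counts members, not weight, so `w` is exchanged for the constant 1/3. No value
  -- is lost: `3 * ∑ w` is the total load, at most `X.card ≤ F.card`.
  have hthird : IsFractionalMatching F fun _ => 1 / 3 := by
    refine ⟨fun _ _ => by norm_num, fun x => ?_⟩
    rw [Finset.sum_const, nsmul_eq_mul]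
    rcases hdeg x with h | h
    · simp only [hd] at h
      rw [h]; norm_num
    · simp only [hd] at h
      rw [h]; norm_num
  have hval : ∑ f ∈ F, w f ≤ ∑ f ∈ F, (1 / 3 : ℝ) := by
    have h := sum_load F w
    have h' : ∑ f ∈ F, (f.card : ℝ) * w f = 3 * ∑ f ∈ F, w f := by
      rw [Finset.mul_sum]
      exact Finset.sum_congr rfl fun f hf => by rw [hcard f (hF hf)]; norm_num
    have h2 : ∑ x, load F w x ≤ ∑ x ∈ X, (1 : ℝ) := by
      rw [← Finset.sum_add_sum_compl X]
      have h3 : ∑ x ∈ Xᶜ, load F w x = 0 := by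
        refine Finset.sum_eq_zero fun x hx => ?_
        have := Finset.sum_eq_zero_iff.mp hXc x hx
        rw [load, Finset.card_eq_zero.mp this, Finset.sum_empty]
      rw [h3, add_zero]
      exact Finset.sum_le_sum fun x _ => hw.2 x
    have h4 : X.card ≤ F.card := by omega
    have h5 : (X.card : ℝ) ≤ F.card := by exact_mod_cast h4
    simp only [Finset.sum_const, nsmul_eq_mul] at h2 ⊢
    linarith
  refine hval.trans (delete P hP hPne hPd _ hthird ?_)
  rw [Finset.sum_const, nsmul_eq_mul]
  have : ((F.filter fun f => ¬ ∀ p ∈ P, Disjoint f p).card : ℝ) ≤ 6 * P.card := by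
    exact_mod_cast hP6
  linarith

end TrianglePacking

namespace TrianglePacking

open Classical

/-! ### Triangles of a graph -/

/-- A finite graph in which every vertex that has a neighbor has at least three of them
contains an even cycle, unless it has no edges. -/
theorem exists_even_cycle {V : Type} [Fintype V] (L : V → V → Prop) (hirr : ∀ a, ¬ L a a)
    (hsymm : ∀ a b, L a b → L b a) (hne : ∃ a b, L a b)
    (hdeg : ∀ a b, L a b → ∃ c d, c ≠ b ∧ d ≠ b ∧ c ≠ d ∧ L a c ∧ L a d) :
    ∃ k, 2 ≤ k ∧ ∃ p : ℕ → V, Set.InjOn p (Set.Iio (2 * k)) ∧ p (2 * k) = p 0 ∧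
      ∀ i < 2 * k, L (p i) (p (i + 1)) := by
  -- `Q n` asserts a path with `n` edges; a longest path has all neighbors of its end `p 0` on
  -- itself.
  let Q : ℕ → Prop := fun n =>
    ∃ p : ℕ → V, Set.InjOn p (Set.Iio (n + 1)) ∧ ∀ i < n, L (p i) (p (i + 1))
  have hQ1 : Q 1 := by
    obtain ⟨a, b, hab⟩ := hne
    have hne : a ≠ b := fun h => hirr a (h ▸ hab)
    refine ⟨fun i => if i = 0 then a else b, ?_, ?_⟩
    · intro i hi j hj hij
      simp only [Set.mem_Iio] at hi hj
      have hi' : i = 0 ∨ i = 1 := by omega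
      have hj' : j = 0 ∨ j = 1 := by omega
      rcases hi' with rfl | rfl <;> rcases hj' with rfl | rfl <;> simp_all
    · intro i hi
      obtain rfl : i = 0 := by omega
      simpa using hab
  have hQb : ∀ n, Q n → n + 1 ≤ Fintype.card V := by
    rintro n ⟨p, hp, -⟩
    have h := Finset.card_le_card_of_injOn (s := Finset.range (n + 1)) (t := Finset.univ) p
      (by simp) (by intro i hi j hj; exact hp (by simpa using hi) (by simpa using hj))
    simpa using h
  obtain ⟨n, hn, hQn, hmax⟩ : ∃ n, 1 ≤ n ∧ Q n ∧ ¬ Q (n + 1) := by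
    by_contra! hcon
    have hall : ∀ n, Q (n + 1) := fun n => by
      induction n with
      | zero => exact hQ1
      | succ n ih => exact hcon _ (by omega) ih
    have := hQb _ (hall (Fintype.card V))
    omega
  obtain ⟨p, hp, hadj⟩ := hQn
  have hnb : ∀ u, L (p 0) u → ∃ i, 1 ≤ i ∧ i ≤ n ∧ u = p i := by
    intro u hu
    by_contra! hcon
    have hu' : ∀ i, i ≤ n → u ≠ p i := by
      intro i hi
      rcases Nat.eq_zero_or_pos i with rfl | h
      · rintro rfl; exact hirr _ hu
      · exact hcon i h hi
    refine hmax ⟨fun i => if i = 0 then u else p (i - 1), ?_, ?_⟩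
    · intro i hi j hj hij
      simp only [Set.mem_Iio] at hi hj
      rcases i with _ | i <;> rcases j with _ | j
      · rfl
      · exact absurd (by simpa using hij) (hu' j (by omega))
      · exact absurd (by simpa using hij.symm) (hu' i (by omega))
      · have : p i = p j := by simpa using hij
        rw [hp (by simp; omega) (by simp; omega) this]
    · intro i hi
      rcases i with _ | i
      · simpa using hsymm _ _ hu
      · simpa using hadj i (by omega)
  -- Two neighbors of `p 0` besides `p 1` give two chords. A chord to an odd index closes an even
  -- cycle with the initial segment; two chords to even indices `i < j` close one of length `j - i +
  -- 2` with the segment between them.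
  obtain ⟨i, j, hi, hij, hj, hLi, hLj⟩ : ∃ i j, 2 ≤ i ∧ i < j ∧ j ≤ n ∧ L (p 0) (p i) ∧
      L (p 0) (p j) := by
    obtain ⟨c, d, hc, hd, hcd, hLc, hLd⟩ := hdeg _ _ (hadj 0 hn)
    obtain ⟨i, hi1, hin, rfl⟩ := hnb c hLc
    obtain ⟨j, hj1, hjn, rfl⟩ := hnb d hLd
    have hi2 : i ≠ 1 := by rintro rfl; exact hc rfl
    have hj2 : j ≠ 1 := by rintro rfl; exact hd rfl
    have hne : i ≠ j := by rintro rfl; exact hcd rfl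
    rcases lt_or_gt_of_ne hne with h | h
    · exact ⟨i, j, by omega, h, hjn, hLc, hLd⟩
    · exact ⟨j, i, by omega, h, hin, hLd, hLc⟩
  have hodd : ∀ m, 2 ≤ m → m ≤ n → m % 2 = 1 → L (p 0) (p m) →
      ∃ k, 2 ≤ k ∧ ∃ p : ℕ → V, Set.InjOn p (Set.Iio (2 * k)) ∧ p (2 * k) = p 0 ∧
        ∀ i < 2 * k, L (p i) (p (i + 1)) := by
    intro m hm hmn hm2 hLm
    refine ⟨(m + 1) / 2, by omega, fun t => if t = m + 1 then p 0 else p t, ?_, ?_, ?_⟩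
    · intro s hs t ht hst
      simp only [Set.mem_Iio] at hs ht
      simp only [show s ≠ m + 1 by omega, show t ≠ m + 1 by omega, if_false] at hst
      exact hp (by simp; omega) (by simp; omega) hst
    · simp [show 2 * ((m + 1) / 2) = m + 1 by omega]
    · intro t ht
      simp only [show t ≠ m + 1 by omega, if_false]
      split_ifs with h
      · obtain rfl : t = m := by omega
        exact hsymm _ _ hLm
      · exact hadj t (by omega)
  by_cases hi2 : i % 2 = 1
  · exact hodd i hi (by omega) hi2 hLi
  by_cases hj2 : j % 2 = 1
  · exact hodd j (by omega) hj hj2 hLj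
  refine ⟨(j - i + 2) / 2, by omega,
    fun t => if t = 0 ∨ t = j - i + 2 then p 0 else p (i + t - 1), ?_, ?_, ?_⟩
  · intro s hs t ht hst
    simp only [Set.mem_Iio] at hs ht
    simp only [show s ≠ j - i + 2 by omega, show t ≠ j - i + 2 by omega, or_false] at hst
    split_ifs at hst with h1 h2 h2
    · omega
    · have := hp (by simp) (by simp; omega) hst
      omega
    · have := hp (by simp; omega) (by simp) hst
      omega
    · have := hp (by simp; omega) (by simp; omega) hst
      omega
  · rw [show 2 * ((j - i + 2) / 2) = j - i + 2 by omega]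
    simp
  · intro t ht
    by_cases h0 : t = 0
    · subst h0
      simpa using hLi
    · by_cases h1 : t + 1 = j - i + 2
      · obtain rfl : t = j - i + 1 := by omega
        simp only [h1, or_true, if_true, show ¬ (j - i + 1 = 0 ∨ j - i + 1 = j - i + 2) by omega,
          if_false, show i + (j - i + 1) - 1 = j by omega]
        exact hsymm _ _ hLj
      · simp only [show ¬ (t = 0 ∨ t = j - i + 2) by omega,
          show ¬ (t + 1 = 0 ∨ t + 1 = j - i + 2) by omega, if_false]
        have := hadj (i + t - 1) (by omega)
        rwa [show i + t - 1 + 1 = i + (t + 1) - 1 by omega] at this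

/-- The edge set of the triangle with vertices `a`, `b`, `c`. -/
noncomputable def triangle {V : Type} (a b c : V) : Finset (Sym2 V) := {s(a, b), s(b, c), s(a, c)}

theorem mem_triangle {V : Type} {a b c : V} {e : Sym2 V} :
    e ∈ triangle a b c ↔ e = s(a, b) ∨ e = s(b, c) ∨ e = s(a, c) := by
  simp [triangle]

theorem triangle_swap {V : Type} (a b c : V) : triangle a b c = triangle b a c := by
  ext e
  simp only [mem_triangle, Sym2.eq_swap (a := b) (b := a)]
  tauto

theorem triangle_swap' {V : Type} (a b c : V) : triangle a b c = triangle a c b := by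
  ext e
  simp only [mem_triangle, Sym2.eq_swap (a := c) (b := b)]
  tauto

theorem mem_triangleFamily {V : Type} [Fintype V] {G : SimpleGraph V} {t : Finset (Sym2 V)} :
    t ∈ triangleFamily G ↔
      ∃ a b c, G.Adj a b ∧ G.Adj b c ∧ G.Adj a c ∧ t = triangle a b c := by
  simp only [triangleFamily, triangle, Finset.mem_filter, Finset.mem_univ, true_and]

theorem card_triangle {V : Type} {a b c : V} (hab : a ≠ b) (hbc : b ≠ c) (hac : a ≠ c) :
    (triangle a b c).card = 3 := by
  rw [triangle, Finset.card_eq_three]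
  refine ⟨_, _, _, ?_, ?_, ?_, rfl⟩
  all_goals
    rw [Ne, Sym2.eq_iff]
    tauto

theorem card_of_mem_triangleFamily {V : Type} [Fintype V] {G : SimpleGraph V}
    {t : Finset (Sym2 V)} (ht : t ∈ triangleFamily G) : t.card = 3 := by
  obtain ⟨a, b, c, hab, hbc, hac, rfl⟩ := mem_triangleFamily.mp ht
  exact card_triangle hab.ne hbc.ne hac.ne

/-- A triangle through the edge `va` is determined by its third vertex. -/
theorem exists_eq_triangle_of_mem {V : Type} [Fintype V] {G : SimpleGraph V}
    {t : Finset (Sym2 V)} (ht : t ∈ triangleFamily G) {v a : V} (h : s(v, a) ∈ t) :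
    ∃ b, G.Adj v a ∧ G.Adj a b ∧ G.Adj v b ∧ t = triangle v a b := by
  obtain ⟨x, y, z, hxy, hyz, hxz, rfl⟩ := mem_triangleFamily.mp ht
  simp only [mem_triangle, Sym2.eq_iff] at h
  rcases h with (⟨rfl, rfl⟩ | ⟨rfl, rfl⟩) | (⟨rfl, rfl⟩ | ⟨rfl, rfl⟩) | (⟨rfl, rfl⟩ | ⟨rfl, rfl⟩)
  · exact ⟨z, hxy, hyz, hxz, rfl⟩
  · exact ⟨z, hxy.symm, hxz, hyz, triangle_swap _ _ _⟩
  · exact ⟨x, hyz, hxz.symm, hxy.symm, by rw [triangle_swap, triangle_swap']⟩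
  · exact ⟨x, hyz.symm, hxy.symm, hxz.symm,
      by rw [triangle_swap', triangle_swap, triangle_swap']⟩
  · exact ⟨y, hxz, hyz.symm, hxy, triangle_swap' _ _ _⟩
  · exact ⟨y, hxz.symm, hxy, hyz.symm, by rw [triangle_swap', triangle_swap]⟩

theorem mem_triangle_apex {V : Type} {v a b c : V} (ha : v ≠ a) (hb : v ≠ b) :
    s(v, c) ∈ triangle v a b ↔ c = a ∨ c = b := by
  simp only [mem_triangle, Sym2.eq_iff]
  constructor
  · rintro ((⟨-, h⟩ | ⟨h, -⟩) | (⟨h, -⟩ | ⟨h, -⟩) | (⟨-, h⟩ | ⟨h, -⟩)) <;> tauto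
  · rintro (rfl | rfl) <;> tauto

/-- A common edge would need two common vertices, and only `v` can be shared. -/
theorem disjoint_triangle {V : Type} {v a b c d : V} (ha : v ≠ a) (hb : v ≠ b)
    (hac : a ≠ c) (had : a ≠ d) (hbc : b ≠ c) (hbd : b ≠ d) :
    Disjoint (triangle v a b) (triangle v c d) := by
  rw [Finset.disjoint_left]
  intro e he he'
  rw [mem_triangle] at he he'
  rcases he with rfl | rfl | rfl <;> rcases he' with h | h | h <;> rw [Sym2.eq_iff] at h <;> grind

/-- In a `3`-regular family of triangles some nonempty matching meets on average at most six
members per triangle: take every other edge of an even cycle in the link of a vertex. -/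
theorem exists_matching_of_regular {V : Type} [Fintype V] (G : SimpleGraph V)
    (F : Finset (Finset (Sym2 V))) (hF : F ⊆ triangleFamily G) (hne : F.Nonempty)
    (hreg : ∀ x, (F.filter fun f => x ∈ f).card = 0 ∨ (F.filter fun f => x ∈ f).card = 3) :
    ∃ P ⊆ F, P.Nonempty ∧ (P : Set (Finset (Sym2 V))).PairwiseDisjoint id ∧
      (F.filter fun f => ¬ ∀ p ∈ P, Disjoint f p).card ≤ 6 * P.card := by
  obtain ⟨f, hf⟩ := hne
  obtain ⟨v, a, b, hva, hab, hvb, rfl⟩ := mem_triangleFamily.mp (hF hf)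
  -- The link of `v` in `F`. Its degree at `a` is the number of members through the edge `va`, which
  -- is 0 or 3.
  let L : V → V → Prop := fun a b => v ≠ a ∧ v ≠ b ∧ a ≠ b ∧ triangle v a b ∈ F
  have hdeg : ∀ a b, L a b → ∃ c d, c ≠ b ∧ d ≠ b ∧ c ≠ d ∧ L a c ∧ L a d := by
    rintro a b ⟨ha, hb, hab, hmem⟩
    have h1 : triangle v a b ∈ F.filter fun f => s(v, a) ∈ f :=
      Finset.mem_filter.mpr ⟨hmem, by simp [mem_triangle]⟩
    have h3 : (F.filter fun f => s(v, a) ∈ f).card = 3 :=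
      (hreg s(v, a)).resolve_left (Finset.card_ne_zero_of_mem h1)
    obtain ⟨g, h, hgh, hgh'⟩ := Finset.card_eq_two.mp
      (show ((F.filter fun f => s(v, a) ∈ f).erase (triangle v a b)).card = 2 by
        rw [Finset.card_erase_of_mem h1, h3])
    have hg : g ∈ (F.filter fun f => s(v, a) ∈ f).erase (triangle v a b) := by
      rw [hgh']; simp
    have hh : h ∈ (F.filter fun f => s(v, a) ∈ f).erase (triangle v a b) := by
      rw [hgh']; simp
    rw [Finset.mem_erase, Finset.mem_filter] at hg hh
    obtain ⟨c, hvc, hac, hvc', rfl⟩ := exists_eq_triangle_of_mem (hF hg.2.1) hg.2.2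
    obtain ⟨d, hvd, had, hvd', rfl⟩ := exists_eq_triangle_of_mem (hF hh.2.1) hh.2.2
    refine ⟨c, d, ?_, ?_, ?_, ⟨hvc.ne, hvc'.ne, hac.ne, hg.2.1⟩, hvd.ne, hvd'.ne, had.ne, hh.2.1⟩
    · rintro rfl; exact hg.1 rfl
    · rintro rfl; exact hh.1 rfl
    · rintro rfl; exact hgh rfl
  obtain ⟨k, hk, p, hp, hp0, hL⟩ := exists_even_cycle L (fun a h => h.2.2.1 rfl)
    (fun a b h => ⟨h.2.1, h.1, h.2.2.1.symm, by rw [triangle_swap']; exact h.2.2.2⟩)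
    ⟨a, b, hva.ne, hvb.ne, hab.ne, hf⟩ hdeg
  have hv : ∀ i ≤ 2 * k, v ≠ p i := fun i hi => by
    rcases hi.lt_or_eq with h | rfl
    · exact (hL i h).1
    · rw [hp0]; exact (hL 0 (by omega)).1
  have hinj : ∀ i j, i < 2 * k → j < 2 * k → p i = p j → i = j := fun i j hi hj h => hp hi hj h
  -- `A` and `B` are the triangles over alternate edges of the cycle; the `A i` form the matching.
  -- The last `B i` wraps around through `p (2 * k) = p 0`.
  let A : ℕ → Finset (Sym2 V) := fun i => triangle v (p (2 * i)) (p (2 * i + 1))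
  let B : ℕ → Finset (Sym2 V) := fun i => triangle v (p (2 * i + 1)) (p (2 * i + 2))
  have hAF : ∀ i < k, A i ∈ F := fun i hi => (hL (2 * i) (by omega)).2.2.2
  have hBF : ∀ i < k, B i ∈ F := fun i hi => (hL (2 * i + 1) (by omega)).2.2.2
  have hAA : ∀ i < k, ∀ j < k, i ≠ j → Disjoint (A i) (A j) := by
    intro i hi j hj hij
    refine disjoint_triangle (hv _ (by omega)) (hv _ (by omega)) ?_ ?_ ?_ ?_ <;>
    · intro h
      have := hinj _ _ (by omega) (by omega) h
      omega
  have hlast : ∀ i < k, ∀ j < k, p (2 * i + 1) ≠ p (2 * j + 2) := by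
    intro i hi j hj h
    rcases (show 2 * j + 2 ≤ 2 * k by omega).lt_or_eq with h' | h'
    · have := hinj _ _ (by omega) h' h
      omega
    · rw [h', hp0] at h
      have := hinj _ _ (by omega) (by omega) h
      omega
  have hBA : ∀ i < k, ∀ j < k, B i ≠ A j := by
    intro i hi j hj h
    have h1 : s(v, p (2 * i + 1)) ∈ A j := by rw [← h]; simp [B, mem_triangle]
    have h2 : s(v, p (2 * i + 2)) ∈ A j := by rw [← h]; simp [B, mem_triangle]
    rw [mem_triangle_apex (hv _ (by omega)) (hv _ (by omega))] at h1 h2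
    have hij : i = j := by
      rcases h1 with h1 | h1 <;> have := hinj _ _ (by omega) (by omega) h1 <;> omega
    subst hij
    rcases h2 with h2 | h2
    · rcases (show 2 * i + 2 ≤ 2 * k by omega).lt_or_eq with h' | h'
      · have := hinj _ _ h' (by omega) h2
        omega
      -- The wrapped index forces `i = 0` and `k = 1`, which `2 ≤ k` excludes.
      · rw [h', hp0] at h2
        have := hinj _ _ (by omega) (by omega) h2
        omega
    · exact hlast i hi i hi h2.symm
  have hBB : ∀ i < k, ∀ j < k, B i = B j → i = j := by
    intro i hi j hj h
    have h1 : s(v, p (2 * i + 1)) ∈ B j := by rw [← h]; simp [B, mem_triangle]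
    rw [mem_triangle_apex (hv _ (by omega)) (hv _ (by omega))] at h1
    rcases h1 with h1 | h1
    · have := hinj _ _ (by omega) (by omega) h1
      omega
    · exact absurd h1 (hlast i hi j hj)
  have hA3 : ∀ i < k, (A i).card = 3 := fun i hi => card_of_mem_triangleFamily (hF (hAF i hi))
  have hAinj : ∀ i < k, ∀ j < k, A i = A j → i = j := by
    intro i hi j hj h
    by_contra hij
    have := hAA i hi j hj hij
    rw [h, disjoint_self] at this
    have h3 := hA3 j hj
    rw [this] at h3
    simp at h3
  set P := (Finset.range k).image A with hP
  set Q := (Finset.range k).image B with hQ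
  have hPk : P.card = k := by
    rw [hP, Finset.card_image_of_injOn, Finset.card_range]
    intro i hi j hj
    exact hAinj i (by simpa using hi) j (by simpa using hj)
  have hQk : Q.card = k := by
    rw [hQ, Finset.card_image_of_injOn, Finset.card_range]
    intro i hi j hj
    exact hBB i (by simpa using hi) j (by simpa using hj)
  have hPF : P ⊆ F := by
    intro f hf
    obtain ⟨i, hi, rfl⟩ := Finset.mem_image.mp hf
    exact hAF i (by simpa using hi)
  have hQF : Q ⊆ F := by
    intro f hf
    obtain ⟨i, hi, rfl⟩ := Finset.mem_image.mp hf
    exact hBF i (by simpa using hi)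
  refine ⟨P, hPF, ?_, ?_, ?_⟩
  · rw [← Finset.card_pos]; omega
  · intro f hf g hg hfg
    obtain ⟨i, hi, rfl⟩ := Finset.mem_image.mp (Finset.mem_coe.mp hf)
    obtain ⟨j, hj, rfl⟩ := Finset.mem_image.mp (Finset.mem_coe.mp hg)
    exact hAA i (by simpa using hi) j (by simpa using hj) (by rintro rfl; exact hfg rfl)
  -- The `3 * k` edges in `U` have at most `9 * k` incidences with `F`. Members of `P` use three
  -- each and those of `Q` at least two, an excess of `2 * k + k` over one per member met; this
  -- leaves at most `6 * k` members.
  · set U := P.biUnion id with hU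
    have hU3 : U.card ≤ 3 * k := by
      refine Finset.card_biUnion_le.trans ?_
      have : ∑ f ∈ P, (id f).card = ∑ f ∈ P, 3 :=
        Finset.sum_congr rfl fun f hf => card_of_mem_triangleFamily (hF (hPF hf))
      rw [this, Finset.sum_const, hPk, smul_eq_mul, mul_comm]
    have hcount : ∑ f ∈ F, (U ∩ f).card ≤ 9 * k := by
      have h1 : ∑ f ∈ F, (U ∩ f).card = ∑ x ∈ U, (F.filter fun f => x ∈ f).card := by
        simp only [Finset.card_filter]
        rw [Finset.sum_comm]
        refine Finset.sum_congr rfl fun f _ => ?_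
        rw [← Finset.card_filter, Finset.filter_mem_eq_inter]
      rw [h1]
      have h2 : ∑ x ∈ U, (F.filter fun f => x ∈ f).card ≤ ∑ x ∈ U, 3 :=
        Finset.sum_le_sum fun x _ => by rcases hreg x with h | h <;> omega
      rw [Finset.sum_const, smul_eq_mul] at h2
      omega
    have hpoint : ∀ f ∈ F, (if ¬ ∀ p ∈ P, Disjoint f p then 1 else 0) +
        ((if f ∈ P then 2 else 0) + if f ∈ Q then 1 else 0) ≤ (U ∩ f).card := by
      intro f hf
      by_cases hfP : f ∈ P
      · have hfQ : f ∉ Q := by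
          intro hfQ
          obtain ⟨i, hi, rfl⟩ := Finset.mem_image.mp hfP
          obtain ⟨j, hj, h⟩ := Finset.mem_image.mp hfQ
          exact hBA j (by simpa using hj) i (by simpa using hi) h
        have hsub : f ⊆ U := Finset.subset_biUnion_of_mem id hfP
        rw [Finset.inter_eq_right.mpr hsub, card_of_mem_triangleFamily (hF hf), if_pos hfP,
          if_neg hfQ]
        split_ifs <;> omega
      · by_cases hfQ : f ∈ Q
        · obtain ⟨i, hi, rfl⟩ := Finset.mem_image.mp hfQ
          have hi : i < k := by simpa using hi
          have hmem : ∀ m < 2 * k, s(v, p m) ∈ U := by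
            intro m hm
            refine Finset.mem_biUnion.mpr
              ⟨A (m / 2), Finset.mem_image_of_mem A (by simp; omega), ?_⟩
            simp only [id, A]
            rw [mem_triangle_apex (hv _ (by omega)) (hv _ (by omega))]
            rcases Nat.mod_two_eq_zero_or_one m with h | h
            · exact Or.inl (by congr 1; omega)
            · exact Or.inr (by congr 1; omega)
          have hmem' : s(v, p (2 * i + 2)) ∈ U := by
            rcases (show 2 * i + 2 ≤ 2 * k by omega).lt_or_eq with h' | h'
            · exact hmem _ h'
            · rw [h', hp0]; exact hmem 0 (by omega)
          have h2 : 1 < (U ∩ B i).card := by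
            rw [Finset.one_lt_card]
            refine ⟨s(v, p (2 * i + 1)), ?_, s(v, p (2 * i + 2)), ?_, ?_⟩
            · exact Finset.mem_inter.mpr ⟨hmem _ (by omega), by simp [B, mem_triangle]⟩
            · exact Finset.mem_inter.mpr ⟨hmem', by simp [B, mem_triangle]⟩
            · intro h
              rw [Sym2.congr_right] at h
              exact hlast i hi i hi h
          rw [if_neg hfP, if_pos hfQ]
          split_ifs <;> omega
        · rw [if_neg hfP, if_neg hfQ]
          split_ifs with h
          · omega
          · push Not at h
            obtain ⟨q, hq, hfq⟩ := h
            rw [Finset.not_disjoint_iff] at hfq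
            obtain ⟨x, hxf, hxq⟩ := hfq
            have : 0 < (U ∩ f).card := Finset.card_pos.mpr
              ⟨x, Finset.mem_inter.mpr ⟨Finset.mem_biUnion.mpr ⟨q, hq, hxq⟩, hxf⟩⟩
            omega
    have htotal := (Finset.sum_le_sum hpoint).trans hcount
    rw [Finset.sum_add_distrib, Finset.sum_add_distrib, ← Finset.card_filter,
      ← Finset.sum_filter, Finset.sum_const, ← Finset.card_filter, Finset.filter_mem_eq_inter,
      Finset.filter_mem_eq_inter, Finset.inter_eq_right.mpr hPF, Finset.inter_eq_right.mpr hQF,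
      hPk, hQk, smul_eq_mul] at htotal
    omega

/-- Krivelevich's inequality. -/
theorem rhoFrac_le_two_mul_rho {V : Type} [Fintype V] (G : SimpleGraph V) :
    rhoFrac G ≤ 2 * rho G := by
  refine csSup_le (rhoFrac_program G).1 ?_
  rintro r ⟨w, hw, rfl⟩
  refine IsFractionalMatching.sum_le_two_mul_matchingNumber
    (fun f hf => card_of_mem_triangleFamily hf) ?_ _ subset_rfl w hw
  convert exists_matching_of_regular G

end TrianglePacking

namespace TrianglePacking

open Classical

/-! ### Fractional packings and the 2-dimensional Weisfeiler-Leman procedure -/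

/-- Two functions with the same multiset of values differ by a bijection of their domains. -/
theorem exists_equiv_of_map_univ_eq {α β γ : Type} [Fintype α] [Fintype β] {f : α → γ}
    {g : β → γ} (h : (Finset.univ : Finset α).val.map f = (Finset.univ : Finset β).val.map g) :
    ∃ e : α ≃ β, ∀ a, f a = g (e a) := by
  have hc : ∀ c, Nonempty ({a // f a = c} ≃ {b // g b = c}) := by
    intro c
    rw [← Fintype.card_eq]
    have := congrArg (Multiset.count c) h
    rw [Multiset.count_map, Multiset.count_map] at this
    rw [Fintype.card_subtype, Fintype.card_subtype, Finset.card_def, Finset.card_def,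
      Finset.filter_val, Finset.filter_val]
    simpa only [eq_comm] using this
  let e := fun c => (hc c).some
  exact ⟨Equiv.ofFiberEquiv e, fun a => (Equiv.ofFiberEquiv_map e a).symm⟩

/-- The average of `X` over the fiber of `τ` above `d`. -/
noncomputable def fiberAverage {Ω D : Type} [Fintype Ω] (τ : Ω → D) (X : Ω → ℝ) (d : D) : ℝ :=
  (∑ t, if τ t = d then X t else 0) / ∑ t, if τ t = d then 1 else 0

/-- Averaging over fibers preserves sums against functions constant on the fibers. Taking `p = 1`
gives the total weight; an indicator of a pair color gives the edge constraints. -/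
theorem sum_mul_fiberAverage {Ω D : Type} [Fintype Ω] (τ : Ω → D) (X : Ω → ℝ) (p : D → ℝ) :
    ∑ t, p (τ t) * fiberAverage τ X (τ t) = ∑ t, p (τ t) * X t := by
  have h1 : ∀ t, p (τ t) * fiberAverage τ X (τ t) =
      ∑ t', if τ t = τ t' then p (τ t') * X t' / (∑ t, if τ t = τ t' then 1 else 0) else 0 := by
    intro t
    rw [fiberAverage, ← mul_div_assoc, Finset.mul_sum, Finset.sum_div]
    refine Finset.sum_congr rfl fun t' _ => ?_
    by_cases h : τ t' = τ t
    · simp [h]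
    · simp [h, Ne.symm h]
  simp_rw [h1]
  rw [Finset.sum_comm]
  refine Finset.sum_congr rfl fun t' _ => ?_
  have h2 : ∀ t, (if τ t = τ t' then p (τ t') * X t' / (∑ t, if τ t = τ t' then 1 else 0) else 0) =
      (p (τ t') * X t' / (∑ t, if τ t = τ t' then 1 else 0)) * if τ t = τ t' then 1 else 0 := by
    intro t; split_ifs <;> simp
  simp_rw [h2]
  rw [← Finset.mul_sum, div_mul_cancel₀]
  have : (0 : ℝ) < ∑ t, if τ t = τ t' then 1 else 0 :=
    Finset.sum_pos' (fun t _ => by split_ifs <;> norm_num) ⟨t', Finset.mem_univ _, by simp⟩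
  exact this.ne'

theorem fiberAverage_nonneg {Ω D : Type} [Fintype Ω] (τ : Ω → D) {X : Ω → ℝ} (hX : ∀ t, 0 ≤ X t)
    (d : D) : 0 ≤ fiberAverage τ X d :=
  div_nonneg (Finset.sum_nonneg fun t _ => by split_ifs <;> simp [hX])
    (Finset.sum_nonneg fun t _ => by split_ifs <;> simp)

theorem fiberAverage_eq_zero {Ω D : Type} [Fintype Ω] {τ : Ω → D} {X : Ω → ℝ} {d : D}
    (h : ∀ t, τ t = d → X t = 0) : fiberAverage τ X d = 0 := by
  have : ∀ t, (if τ t = d then X t else 0) = 0 := fun t => by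
    split_ifs with ht
    · exact h t ht
    · rfl
  simp only [fiberAverage, this, Finset.sum_const_zero, zero_div]

/-- Carries the symmetry of a weight under reordering a triple over to its average. -/
theorem fiberAverage_congr {Ω D : Type} [Fintype Ω] {τ : Ω → D} {X : Ω → ℝ} {d d' : D}
    (σ : Equiv.Perm Ω) (hσ : ∀ t, τ t = d ↔ τ (σ t) = d') (hX : ∀ t, X (σ t) = X t) :
    fiberAverage τ X d = fiberAverage τ X d' := by
  simp only [fiberAverage]
  congr 1
  · rw [← Equiv.sum_comp σ fun t => if τ t = d' then X t else 0]
    exact Finset.sum_congr rfl fun t _ => by simp only [hσ t, hX t]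
  · rw [← Equiv.sum_comp σ fun t => if τ t = d' then (1 : ℝ) else 0]
    exact Finset.sum_congr rfl fun t _ => by simp only [hσ t]

/-! ### Triangle weights as symmetric functions of ordered triples. -/

theorem load_eq_zero {E : Type} {F : Finset (Finset E)} {x : E} (h : ∀ f ∈ F, x ∉ f)
    (w : Finset E → ℝ) : load F w x = 0 :=
  Finset.sum_eq_zero fun f hf =>
    absurd (Finset.mem_filter.mp hf).2 (h f (Finset.mem_filter.mp hf).1)

theorem load_eq_sum {E ι : Type} {F : Finset (Finset E)} {x : E} {I : Finset ι}
    {g : ι → Finset E} (hg : ∀ i ∈ I, g i ∈ F ∧ x ∈ g i) (hinj : Set.InjOn g I)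
    (hsurj : ∀ f ∈ F, x ∈ f → ∃ i ∈ I, g i = f) (w : Finset E → ℝ) :
    load F w x = ∑ i ∈ I, w (g i) := by
  symm
  refine Finset.sum_nbij g (fun i hi => Finset.mem_filter.mpr (hg i hi)) hinj ?_ fun _ _ => rfl
  intro f hf
  obtain ⟨i, hi, h⟩ :=
    hsurj f (Finset.mem_filter.mp hf).1 (Finset.mem_filter.mp hf).2
  exact ⟨i, hi, h⟩

/-- An integral matching is a fractional matching. -/
theorem exists_isFractionalMatching_sum_eq {E : Type} {F P : Finset (Finset E)} (hP : P ⊆ F)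
    (hd : (P : Set (Finset E)).PairwiseDisjoint id) :
    ∃ w, IsFractionalMatching F w ∧ ∑ f ∈ F, w f = P.card := by
  refine ⟨fun t => if t ∈ P then 1 else 0, ⟨fun t _ => by dsimp only; split_ifs <;> norm_num,
    fun j => ?_⟩, ?_⟩
  · rw [← Finset.sum_filter, Finset.sum_const, nsmul_eq_mul, mul_one]
    refine Nat.cast_le_one.mpr (Finset.card_le_one.mpr fun s hs t ht => ?_)
    simp only [Finset.mem_filter] at hs ht
    by_contra hst
    exact Finset.disjoint_left.mp (hd hs.2 ht.2 hst) hs.1.2 ht.1.2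
  · rw [Finset.sum_ite_mem, Finset.inter_eq_right.mpr hP, Finset.sum_const, nsmul_eq_mul, mul_one]

/-- A weight function on triangles, as a function of ordered triples of vertices. -/
noncomputable def tripleWeight {V : Type} (G : SimpleGraph V) (w : Finset (Sym2 V) → ℝ)
    (a u b : V) : ℝ :=
  if G.Adj a u ∧ G.Adj u b ∧ G.Adj a b then w (triangle a u b) else 0

/-- The triangles through `ab` are parametrized by their third vertex. This turns the edge
constraint into a sum over `u`, the kind of sum that refinement controls. -/
theorem sum_tripleWeight {V : Type} [Fintype V] (G : SimpleGraph V) (w : Finset (Sym2 V) → ℝ)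
    (a b : V) : ∑ u, tripleWeight G w a u b =
      if G.Adj a b then load (triangleFamily G) w s(a, b) else 0 := by
  split_ifs with hab
  · simp only [tripleWeight]
    rw [← Finset.sum_filter]
    refine (load_eq_sum ?_ ?_ ?_ w).symm
    · intro u hu
      obtain ⟨h1, h2, h3⟩ := (Finset.mem_filter.mp hu).2
      exact ⟨mem_triangleFamily.mpr ⟨a, u, b, h1, h2, h3, rfl⟩, by simp [mem_triangle]⟩
    · intro u hu u' hu' h
      have hu := (Finset.mem_filter.mp (Finset.mem_coe.mp hu)).2
      have hu' := (Finset.mem_filter.mp (Finset.mem_coe.mp hu')).2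
      have h1 : s(a, u) ∈ triangle a u' b := by
        rw [← show triangle a u b = triangle a u' b from h]; simp [mem_triangle]
      rw [mem_triangle_apex hu'.1.ne hab.ne] at h1
      exact h1.resolve_right hu.2.1.ne
    · intro t ht hte
      obtain ⟨u, -, h1, h2, rfl⟩ := exists_eq_triangle_of_mem ht hte
      exact ⟨u, by simpa using ⟨h2, h1.symm, hab⟩, triangle_swap' _ _ _⟩
  · exact Finset.sum_eq_zero fun u _ => if_neg fun h => hab h.2.2

theorem sum_adj_eq_two_mul_sum {V : Type} [Fintype V] (G : SimpleGraph V) (g : Sym2 V → ℝ) :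
    ∑ p : V × V, (if G.Adj p.1 p.2 then g s(p.1, p.2) else 0) =
      2 * ∑ e, if e ∈ G.edgeSet then g e else 0 := by
  have h := Finset.sum_fiberwise (Finset.univ : Finset (V × V)) (fun p => s(p.1, p.2))
    (fun p => if G.Adj p.1 p.2 then g s(p.1, p.2) else 0)
  rw [← h, Finset.mul_sum]
  refine Finset.sum_congr rfl fun e _ => ?_
  induction e using Sym2.ind with
  | _ a b =>
  have h1 : ∑ p ∈ Finset.univ.filter (fun p : V × V => s(p.1, p.2) = s(a, b)),
      (if G.Adj p.1 p.2 then g s(p.1, p.2) else 0) =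
      ∑ p ∈ Finset.univ.filter (fun p : V × V => s(p.1, p.2) = s(a, b)),
        if G.Adj a b then g s(a, b) else 0 := by
    refine Finset.sum_congr rfl fun p hp => ?_
    have hp := (Finset.mem_filter.mp hp).2
    rw [hp]
    have : G.Adj p.1 p.2 ↔ G.Adj a b := by
      rw [← SimpleGraph.mem_edgeSet, ← SimpleGraph.mem_edgeSet, hp]
    simp only [this]
  rw [h1]
  simp only [SimpleGraph.mem_edgeSet]
  split_ifs with hab
  · rw [Finset.sum_const]
    have h2 : Finset.univ.filter (fun p : V × V => s(p.1, p.2) = s(a, b)) = {(a, b), (b, a)} := by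
      ext ⟨x, y⟩
      simp
    rw [h2, Finset.card_pair (by simpa using fun h _ => hab.ne h), nsmul_eq_mul]
    norm_num
  · simp

/-- A triangle has three edges, each with two orientations: hence the factor 6. -/
theorem sum_sum_tripleWeight {V : Type} [Fintype V] (G : SimpleGraph V)
    (w : Finset (Sym2 V) → ℝ) :
    ∑ p : V × V, ∑ u, tripleWeight G w p.1 u p.2 = 6 * ∑ t ∈ triangleFamily G, w t := by
  simp_rw [sum_tripleWeight]
  rw [sum_adj_eq_two_mul_sum]
  have h1 : ∀ e, (if e ∈ G.edgeSet then load (triangleFamily G) w e else 0) =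
      load (triangleFamily G) w e := by
    intro e
    split_ifs with he
    · rfl
    · refine (load_eq_zero (fun t ht hte => he ?_) w).symm
      induction e using Sym2.ind with
      | _ a b =>
      obtain ⟨-, hab, -⟩ := exists_eq_triangle_of_mem ht hte
      exact hab
  simp_rw [h1]
  rw [sum_load]
  have h2 : ∑ t ∈ triangleFamily G, (t.card : ℝ) * w t = ∑ t ∈ triangleFamily G, 3 * w t :=
    Finset.sum_congr rfl fun t ht => by rw [card_of_mem_triangleFamily ht]; norm_num
  rw [h2, ← Finset.mul_sum]
  ring

/-- A symmetric function of ordered triples depends only on the triangle. -/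
theorem eq_of_triangle_eq {V : Type} {Y : V → V → V → ℝ} (h1 : ∀ a u b, Y a u b = Y u a b)
    (h2 : ∀ a u b, Y a u b = Y a b u) {a b c a' b' c' : V} (hab : a ≠ b) (hbc : b ≠ c)
    (hac : a ≠ c) (hab' : a' ≠ b') (hbc' : b' ≠ c') (hac' : a' ≠ c')
    (h : triangle a b c = triangle a' b' c') : Y a b c = Y a' b' c' := by
  have e1 : s(a', b') ∈ triangle a b c := by rw [h]; simp [mem_triangle]
  have e2 : s(a', c') ∈ triangle a b c := by rw [h]; simp [mem_triangle]
  simp only [mem_triangle, Sym2.eq_iff] at e1 e2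
  rcases e1 with (⟨rfl, rfl⟩ | ⟨rfl, rfl⟩) | (⟨rfl, rfl⟩ | ⟨rfl, rfl⟩) | (⟨rfl, rfl⟩ | ⟨rfl, rfl⟩) <;>
    grind

theorem exists_tripleWeight_eq {V : Type} (G : SimpleGraph V) {Y : V → V → V → ℝ}
    (h1 : ∀ a u b, Y a u b = Y u a b) (h2 : ∀ a u b, Y a u b = Y a b u)
    (h0 : ∀ a u b, ¬ (G.Adj a u ∧ G.Adj u b ∧ G.Adj a b) → Y a u b = 0)
    (hpos : ∀ a u b, 0 ≤ Y a u b) :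
    ∃ w : Finset (Sym2 V) → ℝ, (∀ t, 0 ≤ w t) ∧ ∀ a u b, tripleWeight G w a u b = Y a u b := by
  let R : Finset (Sym2 V) → V × V × V → Prop := fun t p =>
    G.Adj p.1 p.2.1 ∧ G.Adj p.2.1 p.2.2 ∧ G.Adj p.1 p.2.2 ∧ t = triangle p.1 p.2.1 p.2.2
  -- The ordering chosen for the vertices of `t` is immaterial by `eq_of_triangle_eq`.
  refine ⟨fun t => if h : ∃ p, R t p then Y h.choose.1 h.choose.2.1 h.choose.2.2 else 0, ?_, ?_⟩
  · intro t
    dsimp only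
    split_ifs with h
    · exact hpos _ _ _
    · exact le_rfl
  · intro a u b
    unfold tripleWeight
    split_ifs with h
    · have h' : ∃ p, R (triangle a u b) p := ⟨(a, u, b), h.1, h.2.1, h.2.2, rfl⟩
      dsimp only
      rw [dif_pos h']
      obtain ⟨r1, r2, r3, r4⟩ := h'.choose_spec
      exact (eq_of_triangle_eq h1 h2 h.1.ne h.2.1.ne h.2.2.ne r1.ne r2.ne r3.ne r4).symm
    · exact (h0 a u b h).symm

/-- A pair of colorings of ordered pairs of vertices that is jointly stable under refinement
yields, for every fractional triangle packing of one graph, one of the other with the same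
value. -/
theorem exists_fractionalMatching_of_stable {V W C : Type} [Fintype V] [Fintype W]
    {G : SimpleGraph V} {H : SimpleGraph W} {cG : V → V → C} {cH : W → W → C} {rev : C → C}
    (hrevG : ∀ x y, cG y x = rev (cG x y)) (hrevH : ∀ x y, cH y x = rev (cH x y))
    (hadj : ∀ x y x' y', cG x y = cH x' y' → (G.Adj x y ↔ H.Adj x' y'))
    (hstab : ∀ x y x' y', cG x y = cH x' y' →
      ∃ e : V ≃ W, ∀ u, cG x u = cH x' (e u) ∧ cG u y = cH (e u) y')
    (hpal : ∃ e : V × V ≃ W × W, ∀ p, cG p.1 p.2 = cH (e p).1 (e p).2)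
    {w : Finset (Sym2 W) → ℝ} (hw : IsFractionalMatching (triangleFamily H) w) :
    ∃ w', IsFractionalMatching (triangleFamily G) w' ∧
      ∑ t ∈ triangleFamily G, w' t = ∑ t ∈ triangleFamily H, w t := by
  obtain ⟨e, he⟩ := hpal
  let τH : (W × W) × W → C × C × C := fun t => (cH t.1.1 t.1.2, cH t.1.1 t.2, cH t.2 t.1.2)
  let X : (W × W) × W → ℝ := fun t => tripleWeight H w t.1.1 t.2 t.1.2
  let F : C × C × C → ℝ := fiberAverage τH X
  let Y : V → V → V → ℝ := fun a u b => F (cG a b, cG a u, cG u b)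
  have hXpos : ∀ t, 0 ≤ X t := by
    intro t
    simp only [X, tripleWeight]
    split_ifs with h
    · exact hw.1 _ (mem_triangleFamily.mpr ⟨_, _, _, h.1, h.2.1, h.2.2, rfl⟩)
    · exact le_rfl
  have hYpos : ∀ a u b, 0 ≤ Y a u b := fun a u b => fiberAverage_nonneg _ hXpos _
  have hrev : ∀ x y x' y', cH x' y' = cG x y → cH y' x' = cG y x := fun x y x' y' h => by
    rw [hrevH x' y', hrevG x y, h]
  have hY1 : ∀ a u b, Y a u b = Y u a b := by
    intro a u b
    -- Triples are stored as `((a, b), u)` with `u` the middle vertex. This permutation exchanges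
    -- `a` and `u`, the one for `hY2` exchanges `u` and `b`; together they generate all reorderings.
    let σ : Equiv.Perm ((W × W) × W) :=
      ⟨fun t => ((t.2, t.1.2), t.1.1), fun t => ((t.2, t.1.2), t.1.1), fun _ => rfl, fun _ => rfl⟩
    refine fiberAverage_congr σ (fun t => ?_) fun t => ?_
    · simp only [σ, Equiv.coe_fn_mk, τH, Prod.mk.injEq]
      exact ⟨fun h => ⟨h.2.2, hrev _ _ _ _ h.2.1, h.1⟩, fun h => ⟨h.2.2, hrev _ _ _ _ h.2.1, h.1⟩⟩
    · simp only [σ, Equiv.coe_fn_mk, X, tripleWeight]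
      rw [triangle_swap, H.adj_comm]
      congr 1
      apply propext
      tauto
  have hY2 : ∀ a u b, Y a u b = Y a b u := by
    intro a u b
    let σ : Equiv.Perm ((W × W) × W) :=
      ⟨fun t => ((t.1.1, t.2), t.1.2), fun t => ((t.1.1, t.2), t.1.2), fun _ => rfl, fun _ => rfl⟩
    refine fiberAverage_congr σ (fun t => ?_) fun t => ?_
    · simp only [σ, Equiv.coe_fn_mk, τH, Prod.mk.injEq]
      exact ⟨fun h => ⟨h.2.1, h.1, hrev _ _ _ _ h.2.2⟩, fun h => ⟨h.2.1, h.1, hrev _ _ _ _ h.2.2⟩⟩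
    · simp only [σ, Equiv.coe_fn_mk, X, tripleWeight]
      rw [triangle_swap', H.adj_comm t.1.2 t.2]
      congr 1
      apply propext
      tauto
  have hY0 : ∀ a u b, ¬ (G.Adj a u ∧ G.Adj u b ∧ G.Adj a b) → Y a u b = 0 := by
    intro a u b h
    refine fiberAverage_eq_zero fun t ht => ?_
    simp only [τH, Prod.mk.injEq] at ht
    refine if_neg ?_
    rw [← hadj _ _ _ _ ht.1.symm, ← hadj _ _ _ _ ht.2.1.symm, ← hadj _ _ _ _ ht.2.2.symm]
    exact h
  let SH : W × W → ℝ := fun q => ∑ u, F (τH (q, u))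
  -- By stability, the sum over the middle vertex depends only on the color of the outer pair,
  -- across both graphs.
  have hS : ∀ (p : V × V) (q : W × W), cG p.1 p.2 = cH q.1 q.2 → ∑ u, Y p.1 u p.2 = SH q := by
    intro p q hpq
    obtain ⟨e', he'⟩ := hstab _ _ _ _ hpq
    simp only [SH]
    rw [← Equiv.sum_comp e']
    refine Finset.sum_congr rfl fun u _ => ?_
    simp only [Y, τH, hpq, (he' u).1, (he' u).2]
  have hload : ∀ q, ∑ u, X (q, u) ≤ 1 := by
    intro q
    simp only [X]
    rw [sum_tripleWeight]
    split_ifs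
    · exact hw.2 _
    · norm_num
  obtain ⟨w', hw'pos, hw'⟩ := exists_tripleWeight_eq G hY1 hY2 hY0 hYpos
  refine ⟨w', ⟨fun t _ => hw'pos t, fun j => ?_⟩, ?_⟩
  · induction j using Sym2.ind with
    | _ a b =>
    change load (triangleFamily G) w' s(a, b) ≤ 1
    by_cases hab : G.Adj a b
    · have h1 := sum_tripleWeight G w' a b
      rw [if_pos hab] at h1
      rw [← h1]
      simp only [hw']
      -- Summed over the pairs of `H` colored like `(a, b)`, the averaged loads are all equal and
      -- have the same total as the original loads, each at most 1. The class is nonempty by `he`,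
      -- so one may divide by its size.
      let p : C × C × C → ℝ := fun d => if d.1 = cG a b then 1 else 0
      have h2 := sum_mul_fiberAverage τH X p
      rw [Fintype.sum_prod_type, Fintype.sum_prod_type (f := fun t => p (τH t) * X t)] at h2
      have h3 : ∀ q : W × W, ∑ u, p (τH (q, u)) * fiberAverage τH X (τH (q, u)) =
          (if cH q.1 q.2 = cG a b then 1 else 0) * ∑ u, Y a u b := by
        intro q
        by_cases hq : cH q.1 q.2 = cG a b
        · rw [hS (a, b) q hq.symm]
          simp [p, τH, hq, SH, F]
        · simp [p, τH, hq]
      have h4 : ∀ q : W × W, ∑ u, p (τH (q, u)) * X (q, u) ≤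
          if cH q.1 q.2 = cG a b then 1 else 0 := by
        intro q
        by_cases hq : cH q.1 q.2 = cG a b
        · simpa [p, τH, hq] using hload q
        · simp [p, τH, hq]
      have h5 := h2.trans_le (Finset.sum_le_sum fun q _ => h4 q)
      simp only [h3] at h5
      rw [← Finset.sum_mul] at h5
      have h6 : (0 : ℝ) < ∑ q : W × W, if cH q.1 q.2 = cG a b then 1 else 0 :=
        Finset.sum_pos' (fun t _ => by split_ifs <;> norm_num)
          ⟨e (a, b), Finset.mem_univ _, by simp [← he]⟩
      nlinarith
    · rw [load_eq_zero fun t ht hte => ?_]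
      · norm_num
      · obtain ⟨-, h, -⟩ := exists_eq_triangle_of_mem ht hte
        exact hab h
  · have h1 := sum_sum_tripleWeight G w'
    have h2 := sum_sum_tripleWeight H w
    have h3 : ∑ p : V × V, ∑ u, tripleWeight G w' p.1 u p.2 = ∑ q, SH q := by
      rw [← Equiv.sum_comp e]
      refine Finset.sum_congr rfl fun p _ => ?_
      simp only [hw']
      exact hS p (e p) (he p)
    have h4 := sum_mul_fiberAverage τH X fun _ => 1
    simp only [one_mul] at h4
    rw [Fintype.sum_prod_type, Fintype.sum_prod_type (f := X)] at h4
    have h5 : ∑ q, SH q = ∑ q : W × W, ∑ u, tripleWeight H w q.1 u q.2 := h4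
    linarith

/-! ### Stabilization of the refinement. -/

/-- The color of a pair determines the color of the reversed pair. -/
theorem exists_wl2_reverse (r : ℕ) : ∃ rev : WL2Color r → WL2Color r,
    ∀ (V : Type) [Fintype V] (G : SimpleGraph V) (x y : V), wl2 G r y x = rev (wl2 G r x y) := by
  induction r with
  | zero =>
    refine ⟨fun M => Matrix.of fun i j => M (Fin.rev i) (Fin.rev j), fun V _ G x y => ?_⟩
    refine Matrix.ext fun i j => ?_
    fin_cases i <;> fin_cases j <;> rfl
  | succ r ih =>
    obtain ⟨rev, hrev⟩ := ih
    refine ⟨fun c => (rev c.1, c.2.map fun d => (rev d.2, rev d.1)), fun V _ G x y => ?_⟩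
    simp only [wl2, Multiset.map_map, Function.comp_def]
    refine Prod.ext (hrev V G x y) ?_
    refine Multiset.map_congr rfl fun u _ => ?_
    rw [← hrev, ← hrev]

theorem adj_iff_of_wl2_eq {V W : Type} [Fintype V] [Fintype W] {G : SimpleGraph V}
    {H : SimpleGraph W} {r : ℕ} {x y : V} {x' y' : W} (h : wl2 G r x y = wl2 H r x' y') :
    G.Adj x y ↔ H.Adj x' y' := by
  induction r with
  | zero =>
    have h01 : atomicType G x y = atomicType H x' y' := congrFun (congrFun h 0) 1
    unfold atomicType at h01
    split_ifs at h01 <;> simp_all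
  | succ r ih => exact ih (congrArg Prod.fst h)

/-- The color of the preceding round. -/
def previousColor {r : ℕ} (c : WL2Color (r + 1)) : WL2Color r := Prod.fst c

theorem map_previousColor_wl2Palette {V : Type} [Fintype V] (G : SimpleGraph V) (r : ℕ) :
    (wl2Palette G (r + 1)).map previousColor = wl2Palette G r := by
  rw [wl2Palette, Multiset.map_map]
  rfl

theorem wl2Palette_eq_of_le {V W : Type} [Fintype V] [Fintype W] {G : SimpleGraph V}
    {H : SimpleGraph W} {r n : ℕ} (hrn : r ≤ n) (h : wl2Palette G n = wl2Palette H n) :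
    wl2Palette G r = wl2Palette H r := by
  induction n, hrn using Nat.le_induction with
  | base => exact h
  | succ n _ ih => exact ih (by rw [← map_previousColor_wl2Palette, h, map_previousColor_wl2Palette])

theorem wl2_mem_wl2Palette {V : Type} [Fintype V] (G : SimpleGraph V) (r : ℕ) (x y : V) :
    wl2 G r x y ∈ wl2Palette G r :=
  Multiset.mem_map.mpr ⟨(x, y), Finset.mem_univ _, rfl⟩

/-- For equivalent graphs the refinement becomes stable, on both graphs together. -/
theorem WL2Equiv.exists_stable {V W : Type} [Fintype V] [Fintype W] {G : SimpleGraph V}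
    {H : SimpleGraph W} (h : WL2Equiv G H) :
    ∃ r, wl2Palette G r = wl2Palette H r ∧
      ∀ x y x' y', wl2 G r x y = wl2 H r x' y' → wl2 G (r + 1) x y = wl2 H (r + 1) x' y' := by
  rcases isEmpty_or_nonempty V with hV | hV
  -- Without vertices there is no initial color, so the count below could not start at 1.
  · exact ⟨0, wl2Palette_eq_of_le (Nat.zero_le _) h.2, fun x => isEmptyElim x⟩
  let K : (r : ℕ) → Set (WL2Color r) := fun r => Set.range fun p : V × V => wl2 G r p.1 p.2
  have hK : ∀ r, previousColor '' K (r + 1) = K r := fun r => (Set.range_comp _ _).symm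
  have hfin : ∀ r, (K r).Finite := fun r => Set.finite_range _
  have hK0 : 0 < (K 0).ncard := by
    obtain ⟨x⟩ := hV
    exact (Set.ncard_pos (hfin 0)).mpr ⟨_, (x, x), rfl⟩
  -- If the number of colors on `G` grew in each of the `n ^ 2` rounds, there would be more than `n
  -- ^ 2` colors on `n ^ 2` pairs.
  obtain ⟨r, hr, hle⟩ : ∃ r < Fintype.card V ^ 2, (K (r + 1)).ncard ≤ (K r).ncard := by
    by_contra! hcon
    have hgrow : ∀ r ≤ Fintype.card V ^ 2, r + 1 ≤ (K r).ncard := by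
      intro r
      induction r with
      | zero => intro _; exact hK0
      | succ r ih =>
        intro hr
        have := hcon r (by omega)
        have := ih (by omega)
        omega
    have h1 := hgrow _ le_rfl
    have h2 : (K (Fintype.card V ^ 2)).ncard ≤ Fintype.card V ^ 2 := by
      have : (K (Fintype.card V ^ 2)).ncard ≤ (Set.univ : Set (V × V)).ncard := by
        simp only [K]
        rw [← Set.image_univ]
        exact Set.ncard_image_le
      simpa [sq] using this
    omega
  refine ⟨r, wl2Palette_eq_of_le hr.le h.2, fun x y x' y' hxy => ?_⟩
  have hinj : Set.InjOn previousColor (K (r + 1)) := by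
    refine Set.injOn_of_ncard_image_eq ?_ (hfin _)
    refine le_antisymm (Set.ncard_image_le (hfin _)) ?_
    rw [hK]
    exact hle
  -- Since `r + 1` is still at most `n ^ 2`, the palettes agree there too; colors of `H` thus lie
  -- where `previousColor` is injective.
  have hmem : wl2 H (r + 1) x' y' ∈ wl2Palette G (r + 1) := by
    rw [wl2Palette_eq_of_le hr h.2]
    exact wl2_mem_wl2Palette H _ x' y'
  obtain ⟨p, -, hp⟩ := Multiset.mem_map.mp hmem
  exact hinj ⟨(x, y), rfl⟩ ⟨p, hp⟩ hxy

theorem WL2Equiv.exists_fractionalMatching {V W : Type} [Fintype V] [Fintype W]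
    {G : SimpleGraph V} {H : SimpleGraph W} (h : WL2Equiv G H) {w : Finset (Sym2 W) → ℝ}
    (hw : IsFractionalMatching (triangleFamily H) w) :
    ∃ w', IsFractionalMatching (triangleFamily G) w' ∧
      ∑ t ∈ triangleFamily G, w' t = ∑ t ∈ triangleFamily H, w t := by
  obtain ⟨r, hpal, hstab⟩ := h.exists_stable
  obtain ⟨rev, hrev⟩ := exists_wl2_reverse r
  refine exists_fractionalMatching_of_stable (cG := wl2 G r) (cH := wl2 H r) (hrev V G)
    (hrev W H) (fun _ _ _ _ h => adj_iff_of_wl2_eq h) (fun x y x' y' hxy => ?_)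
    (exists_equiv_of_map_univ_eq hpal) hw
  have h2 := congrArg Prod.snd (hstab x y x' y' hxy)
  obtain ⟨e, he⟩ := exists_equiv_of_map_univ_eq h2
  exact ⟨e, fun u => ⟨congrArg Prod.snd (he u), congrArg Prod.fst (he u)⟩⟩

theorem IsFractionalMatching.sum_le_rhoFrac {V : Type} [Fintype V] {G : SimpleGraph V}
    {w : Finset (Sym2 V) → ℝ} (hw : IsFractionalMatching (triangleFamily G) w) :
    ∑ t ∈ triangleFamily G, w t ≤ rhoFrac G :=
  le_csSup (rhoFrac_program G).2 ⟨w, hw, rfl⟩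

theorem WL2Equiv.symm {V W : Type} [Fintype V] [Fintype W] {G : SimpleGraph V}
    {H : SimpleGraph W} (h : WL2Equiv G H) : WL2Equiv H G :=
  ⟨h.1.symm, by rw [← h.1]; exact h.2.symm⟩

/-- The fractional triangle packing number is invariant under equivalence. -/
theorem WL2Equiv.rhoFrac_eq {V W : Type} [Fintype V] [Fintype W] {G : SimpleGraph V}
    {H : SimpleGraph W} (h : WL2Equiv G H) : rhoFrac G = rhoFrac H := by
  apply le_antisymm
  · refine csSup_le (rhoFrac_program G).1 ?_
    rintro r ⟨w, hw, rfl⟩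
    obtain ⟨w', hw', h'⟩ := h.symm.exists_fractionalMatching hw
    rw [← h']
    exact hw'.sum_le_rhoFrac
  · refine csSup_le (rhoFrac_program H).1 ?_
    rintro r ⟨w, hw, rfl⟩
    obtain ⟨w', hw', h'⟩ := h.exists_fractionalMatching hw
    rw [← h']
    exact hw'.sum_le_rhoFrac

theorem rho_le_rhoFrac {V : Type} [Fintype V] (G : SimpleGraph V) : (rho G : ℝ) ≤ rhoFrac G := by
  obtain ⟨P, hP, hd, hc⟩ := exists_card_eq_matchingNumber (triangleFamily G)
  obtain ⟨w, hw, h⟩ := exists_isFractionalMatching_sum_eq hP hd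
  rw [rho, ← hc, ← h]
  exact hw.sum_le_rhoFrac

end TrianglePacking

namespace TrianglePacking

/-! ### Graphs on which the procedure stops immediately -/

theorem atomicType_self {V : Type} (G : SimpleGraph V) (x : V) : atomicType G x x = 2 := by
  simp [atomicType]

theorem atomicType_comm {V : Type} (G : SimpleGraph V) (x y : V) :
    atomicType G x y = atomicType G y x := by
  by_cases h : x = y
  · rw [h]
  · by_cases hG : G.Adj x y
    · simp [atomicType, hG, hG.symm]
    · simp [atomicType, hG, mt SimpleGraph.Adj.symm hG, h, Ne.symm h]

/-- Replaces the classical decidability instance by a computable one, so that `decide` can evaluate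
atomic types. -/
theorem atomicType_eq {V : Type} [DecidableEq V] (G : SimpleGraph V) [DecidableRel G.Adj]
    (x y : V) : atomicType G x y = if G.Adj x y then 1 else if x = y then 2 else 0 := by
  unfold atomicType
  congr

/-- If the atomic types are already stable, with structure constants `M`, then all later colors are
functions of the atomic type that depend only on `M`. -/
theorem exists_wl2_eq_of_atomicType_stable (M : ℕ → Multiset (ℕ × ℕ)) (r : ℕ) :
    ∃ f : ℕ → WL2Color r, ∀ (V : Type) [Fintype V] (G : SimpleGraph V),
      (∀ x y, ((Finset.univ : Finset V).val.map fun u => (atomicType G u y, atomicType G x u)) =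
        M (atomicType G x y)) →
      ∀ x y, wl2 G r x y = f (atomicType G x y) := by
  induction r with
  | zero =>
    -- The diagonal entries compare a vertex with itself, giving 2; the two others agree because
    -- adjacency and equality are symmetric.
    refine ⟨fun c => Matrix.of fun i j => if i = j then 2 else c, fun V _ G _ x y => ?_⟩
    refine Matrix.ext fun i j => ?_
    fin_cases i <;> fin_cases j
    · exact atomicType_self G x
    · rfl
    · exact atomicType_comm G y x
    · exact atomicType_self G y
  | succ r ih =>
    obtain ⟨f, hf⟩ := ih
    refine ⟨fun c => (f c, (M c).map fun d => (f d.1, f d.2)), fun V _ G hG x y => ?_⟩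
    refine Prod.ext (hf V G hG x y) ?_
    simp only [wl2, ← hG x y, Multiset.map_map, Function.comp_def, hf V G hG]

/-- Sharing `M` makes the colors of both graphs the same function of the atomic type, so equal
counts of atomic types suffice. -/
theorem WL2Equiv.of_atomicType_stable {V W : Type} [Fintype V] [Fintype W] {G : SimpleGraph V}
    {H : SimpleGraph W} (M : ℕ → Multiset (ℕ × ℕ)) (hcard : Fintype.card V = Fintype.card W)
    (hG : ∀ x y, ((Finset.univ : Finset V).val.map fun u =>
      (atomicType G u y, atomicType G x u)) = M (atomicType G x y))
    (hH : ∀ x y, ((Finset.univ : Finset W).val.map fun u =>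
      (atomicType H u y, atomicType H x u)) = M (atomicType H x y))
    (hpal : ((Finset.univ : Finset (V × V)).val.map fun p => atomicType G p.1 p.2) =
      (Finset.univ : Finset (W × W)).val.map fun p => atomicType H p.1 p.2) :
    WL2Equiv G H := by
  refine ⟨hcard, ?_⟩
  obtain ⟨f, hf⟩ := exists_wl2_eq_of_atomicType_stable M (Fintype.card V ^ 2)
  have h := congrArg (Multiset.map f) hpal
  simp only [Multiset.map_map, Function.comp_def] at h
  simp only [wl2Palette, hf V G hG, hf W H hH]
  exact h

/-! ### Bounds for the packing number -/

theorem card_le_rho {V ι : Type} [Fintype V] [Fintype ι] (G : SimpleGraph V) (a b c : ι → V)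
    (hadj : ∀ i, G.Adj (a i) (b i) ∧ G.Adj (b i) (c i) ∧ G.Adj (a i) (c i))
    (hdisj : ∀ i j, i ≠ j → ∀ e ∈ [s(a i, b i), s(b i, c i), s(a i, c i)],
      e ∉ [s(a j, b j), s(b j, c j), s(a j, c j)]) : Fintype.card ι ≤ rho G := by
  classical
  have hd : ∀ i j, i ≠ j →
      Disjoint (triangle (a i) (b i) (c i)) (triangle (a j) (b j) (c j)) := by
    intro i j hij
    rw [Finset.disjoint_left]
    intro e he he'
    exact hdisj i j hij e (by simpa [mem_triangle] using he) (by simpa [mem_triangle] using he')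
  have hinj : Function.Injective fun i => triangle (a i) (b i) (c i) := by
    intro i j h
    by_contra hij
    have h1 := hd i j hij
    have h2 : s(a i, b i) ∈ triangle (a i) (b i) (c i) := by simp [mem_triangle]
    exact Finset.disjoint_left.mp h1 h2 ((show triangle _ _ _ = triangle _ _ _ from h) ▸ h2)
  rw [← Finset.card_univ, ← Finset.card_image_of_injective _ hinj]
  refine card_le_matchingNumber ?_ ?_
  · intro t ht
    obtain ⟨i, -, rfl⟩ := Finset.mem_image.mp ht
    exact mem_triangleFamily.mpr ⟨_, _, _, (hadj i).1, (hadj i).2.1, (hadj i).2.2, rfl⟩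
  · intro t ht t' ht' hne
    obtain ⟨i, -, rfl⟩ := Finset.mem_image.mp (Finset.mem_coe.mp ht)
    obtain ⟨j, -, rfl⟩ := Finset.mem_image.mp (Finset.mem_coe.mp ht')
    exact hd i j (by rintro rfl; exact hne rfl)

/-- The triangles of a packing occupy pairwise disjoint triples of edges. -/
theorem three_mul_rho_le_card_edgeFinset {V : Type} [Fintype V] (G : SimpleGraph V)
    [Fintype G.edgeSet] : 3 * rho G ≤ G.edgeFinset.card := by
  classical
  obtain ⟨P, hP, hd, hc⟩ := exists_card_eq_matchingNumber (triangleFamily G)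
  have h1 : (P.biUnion id).card = ∑ t ∈ P, t.card := Finset.card_biUnion hd
  have h2 : ∑ t ∈ P, t.card = ∑ t ∈ P, 3 :=
    Finset.sum_congr rfl fun t ht => card_of_mem_triangleFamily (hP ht)
  rw [rho, ← hc, mul_comm, ← smul_eq_mul, ← Finset.sum_const, ← h2, ← h1]
  refine Finset.card_le_card fun e he => ?_
  obtain ⟨t, ht, het⟩ := Finset.mem_biUnion.mp he
  rw [SimpleGraph.mem_edgeFinset]
  induction e using Sym2.ind with
  | _ x y =>
  obtain ⟨-, h, -⟩ := exists_eq_triangle_of_mem (hP ht) het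
  exact h

/-- If every triangle lies in one of the `4`-element sets `K i`, there are no more edge-disjoint
triangles than sets. -/
theorem rho_le_card_of_subset {V ι : Type} [Fintype V] [DecidableEq V] [Fintype ι]
    (G : SimpleGraph V) (K : ι → Finset V) (hK : ∀ i, (K i).card = 4)
    (h : ∀ a b c, G.Adj a b → G.Adj b c → G.Adj a c → ∃ i, a ∈ K i ∧ b ∈ K i ∧ c ∈ K i) :
    rho G ≤ Fintype.card ι := by
  refine matchingNumber_le fun P hP hd => ?_
  have hline : ∀ t : P, ∃ i, ∃ s ⊆ K i, s.card = 3 ∧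
      ∀ x ∈ s, ∀ y ∈ s, x ≠ y → s(x, y) ∈ t.1 := by
    rintro ⟨t, ht⟩
    obtain ⟨a, b, c, hab, hbc, hac, rfl⟩ := mem_triangleFamily.mp (hP ht)
    obtain ⟨i, ha, hb, hc⟩ := h a b c hab hbc hac
    refine ⟨i, {a, b, c}, ?_, Finset.card_eq_three.mpr ⟨a, b, c, hab.ne, hac.ne, hbc.ne, rfl⟩, ?_⟩
    · intro x hx
      simp only [Finset.mem_insert, Finset.mem_singleton] at hx
      rcases hx with rfl | rfl | rfl <;> assumption
    · intro x hx y hy hxy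
      simp only [Finset.mem_insert, Finset.mem_singleton] at hx hy
      rw [mem_triangle]
      simp only [Sym2.eq_iff]
      rcases hx with rfl | rfl | rfl <;> rcases hy with rfl | rfl | rfl <;> simp_all
  choose i s hs hs3 hst using hline
  have hinj : Function.Injective i := by
    intro t t' htt
    by_contra hne
    -- Two 3-subsets of a 4-set share at least two points, so the triangles share an edge.
    have h1 := Finset.card_union_add_card_inter (s t) (s t')
    have h2 : (s t ∪ s t').card ≤ 4 := by
      rw [← hK (i t)]
      exact Finset.card_le_card (Finset.union_subset (hs t) (htt ▸ hs t'))
    rw [hs3, hs3] at h1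
    obtain ⟨x, hx, y, hy, hxy⟩ := Finset.one_lt_card.mp (show 1 < (s t ∩ s t').card by omega)
    rw [Finset.mem_inter] at hx hy
    exact Finset.disjoint_left.mp (hd t.2 t'.2 fun h => hne (Subtype.ext h))
      (hst t x hx.1 y hy.1 hxy) (hst t' x hx.2 y hy.2 hxy)
  simpa using Fintype.card_le_of_injective i hinj

/-! ### The Shrikhande graph and the rook's graph -/

instance decidableAdjShrikhande : DecidableRel shrikhande.Adj := fun p q =>
  inferInstanceAs (Decidable (p ≠ q ∧
    (((p.1 = q.1 ∧ q.2 = p.2 + 1) ∨ (p.2 = q.2 ∧ q.1 = p.1 + 1) ∨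
      (q.1 = p.1 + 1 ∧ q.2 = p.2 + 1)) ∨
    ((q.1 = p.1 ∧ p.2 = q.2 + 1) ∨ (q.2 = p.2 ∧ p.1 = q.1 + 1) ∨
      (p.1 = q.1 + 1 ∧ p.2 = q.2 + 1)))))

instance decidableAdjRook : DecidableRel rook.Adj := fun p q =>
  inferInstanceAs (Decidable (p ≠ q ∧ ((p.1 = q.1 ∨ p.2 = q.2) ∨ (q.1 = p.1 ∨ q.2 = p.2))))

/-- The number of vertices of each pair of types with respect to a pair of vertices of a given
type, in a strongly regular graph with parameters `(16, 6, 2, 2)`. -/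
def structureConstants : ℕ → Multiset (ℕ × ℕ)
  | 0 => {(0, 2), (2, 0)} + .replicate 2 (1, 1) + .replicate 4 (0, 1) + .replicate 4 (1, 0) +
      .replicate 4 (0, 0)
  | 1 => {(1, 2), (2, 1)} + .replicate 2 (1, 1) + .replicate 3 (0, 1) + .replicate 3 (1, 0) +
      .replicate 6 (0, 0)
  | _ => {(2, 2)} + .replicate 6 (1, 1) + .replicate 9 (0, 0)

theorem shrikhande_stable (x y : ZMod 4 × ZMod 4) :
    ((Finset.univ : Finset (ZMod 4 × ZMod 4)).val.map fun u =>
      (atomicType shrikhande u y, atomicType shrikhande x u)) =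
        structureConstants (atomicType shrikhande x y) := by
  simp only [atomicType_eq]
  revert x y
  decide +kernel

theorem rook_stable (x y : ZMod 4 × ZMod 4) :
    ((Finset.univ : Finset (ZMod 4 × ZMod 4)).val.map fun u =>
      (atomicType rook u y, atomicType rook x u)) =
        structureConstants (atomicType rook x y) := by
  simp only [atomicType_eq]
  revert x y
  decide +kernel

theorem wl2Equiv_shrikhande_rook : WL2Equiv shrikhande rook := by
  refine .of_atomicType_stable structureConstants rfl shrikhande_stable rook_stable ?_
  simp only [atomicType_eq]
  decide +kernel

theorem rho_shrikhande : rho shrikhande = 16 := by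
  apply le_antisymm
  -- A 6-regular graph on 16 vertices has 48 edges.
  · have h1 := three_mul_rho_le_card_edgeFinset shrikhande
    have h2 := shrikhande.sum_degrees_eq_twice_card_edges
    have h3 : ∀ v, shrikhande.degree v = 6 := by decide +kernel
    simp only [h3, Finset.sum_const, Finset.card_univ, Fintype.card_prod, ZMod.card] at h2
    simp only [smul_eq_mul] at h2
    omega
  -- One triangle per vertex `p`, all translates of one another. Their sides have differences `(0,
  -- 1)`, `(1, 0)` and `(1, 1)`, so each edge is used once.
  · have h := card_le_rho shrikhande (fun p : ZMod 4 × ZMod 4 => p) (fun p => p + (0, 1))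
      (fun p => p + (1, 1)) (by decide +kernel) (by decide +kernel)
    simpa using h

theorem rho_rook : rho rook = 8 := by
  apply le_antisymm
  -- Every triangle lies in one of the eight rows and columns, each a 4-clique; conversely, one
  -- triangle is taken from each line.
  · have h := rho_le_card_of_subset rook
      (fun l : Bool × ZMod 4 => Finset.univ.filter fun p : ZMod 4 × ZMod 4 =>
        (if l.1 then p.1 else p.2) = l.2) (by decide +kernel) (by decide +kernel)
    simpa using h
  · have h := card_le_rho rook
      (fun l : Bool × ZMod 4 => if l.1 then (l.2, 0) else (0, l.2))
      (fun l => if l.1 then (l.2, 1) else (1, l.2))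
      (fun l => if l.1 then (l.2, 2) else (2, l.2)) (by decide +kernel) (by decide +kernel)
    simpa using h

/-! ### The integrality gap and the invariance ratio -/

theorem rho_pos {V : Type} [Fintype V] {G : SimpleGraph V} (h : ¬ G.CliqueFree 3) :
    0 < rho G := by
  classical
  simp only [SimpleGraph.CliqueFree, not_forall, not_not] at h
  obtain ⟨t, ht⟩ := h
  obtain ⟨a, b, c, hab, hac, hbc, -⟩ := SimpleGraph.is3Clique_iff.mp ht
  have := card_le_rho G (fun _ : Unit => a) (fun _ => b) (fun _ => c) (fun _ => ⟨hab, hbc, hac⟩)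
    (fun i j h => absurd rfl h)
  simpa [Nat.one_le_iff_ne_zero, Nat.pos_iff_ne_zero] using this

theorem not_cliqueFree_of_rho_pos {V : Type} [Fintype V] {G : SimpleGraph V} (h : 0 < rho G) :
    ¬ G.CliqueFree 3 := by
  classical
  obtain ⟨P, hP, -, hc⟩ := exists_card_eq_matchingNumber (triangleFamily G)
  obtain ⟨t, ht⟩ := Finset.card_pos.mp (show 0 < P.card by rw [hc]; exact h)
  obtain ⟨a, b, c, hab, hbc, hac, -⟩ := mem_triangleFamily.mp (hP ht)
  exact fun hfree => hfree _ (SimpleGraph.is3Clique_triple_iff.mpr ⟨hab, hac, hbc⟩)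

theorem shrikhande_not_cliqueFree : ¬ shrikhande.CliqueFree 3 :=
  not_cliqueFree_of_rho_pos (by rw [rho_shrikhande]; norm_num)

theorem rook_not_cliqueFree : ¬ rook.CliqueFree 3 :=
  not_cliqueFree_of_rho_pos (by rw [rho_rook]; norm_num)

theorem integralityGap_eq_two : integralityGap = 2 := by
  apply le_antisymm
  · refine sSup_le ?_
    rintro q ⟨V, _, G, hG, rfl⟩
    have h : (0 : ℝ) < rho G := Nat.cast_pos.mpr (rho_pos hG)
    have : rhoFrac G / (rho G : ℝ) ≤ (2 : ℝ) :=
      (div_le_iff₀ h).mpr (rhoFrac_le_two_mul_rho G)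
    exact EReal.coe_le_coe_iff.mpr this
  · refine le_sSup_of_le (b := ((rhoFrac rook / (rho rook : ℝ) : ℝ) : EReal))
      ⟨_, inferInstance, rook, rook_not_cliqueFree, rfl⟩ ?_
    -- The integral packing of the Shrikhande graph, moved by invariance, bounds `rhoFrac rook` from
    -- below by 16.
    have h := rho_le_rhoFrac shrikhande
    rw [wl2Equiv_shrikhande_rook.rhoFrac_eq, rho_shrikhande] at h
    have : (2 : ℝ) ≤ rhoFrac rook / (rho rook : ℝ) := by
      rw [rho_rook, le_div_iff₀ (by norm_num)]
      push_cast at h ⊢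
      linarith
    exact EReal.coe_le_coe_iff.mpr this

theorem invarianceRatio_eq_two : invarianceRatio = 2 := by
  apply le_antisymm
  · refine sSup_le ?_
    rintro q ⟨V, W, _, _, G, H, hG, hH, hGH, rfl⟩
    have h : (0 : ℝ) < rho H := Nat.cast_pos.mpr (rho_pos hH)
    have : |(rho G : ℝ) / (rho H : ℝ)| ≤ (2 : ℝ) := by
      rw [abs_of_nonneg (by positivity), div_le_iff₀ h]
      calc (rho G : ℝ) ≤ rhoFrac G := rho_le_rhoFrac G
        _ = rhoFrac H := hGH.rhoFrac_eq
        _ ≤ 2 * rho H := rhoFrac_le_two_mul_rho H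
    exact EReal.coe_le_coe_iff.mpr this
  · refine le_sSup_of_le (b := ((|(rho shrikhande : ℝ) / (rho rook : ℝ)| : ℝ) : EReal))
      ⟨_, _, inferInstance, inferInstance, shrikhande, rook, shrikhande_not_cliqueFree,
        rook_not_cliqueFree, wl2Equiv_shrikhande_rook, rfl⟩ ?_
    have : (2 : ℝ) ≤ |(rho shrikhande : ℝ) / (rho rook : ℝ)| := by
      rw [rho_shrikhande, rho_rook]
      norm_num
    exact EReal.coe_le_coe_iff.mpr this

end TrianglePacking

theorem theorem6 :
    TrianglePacking.integralityGap = 2 ∧ TrianglePacking.invarianceRatio = 2 ∧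
      (TrianglePacking.WL2Equiv TrianglePacking.shrikhande TrianglePacking.rook ∧
        TrianglePacking.rho TrianglePacking.shrikhande = 16 ∧
        TrianglePacking.rho TrianglePacking.rook = 8) :=
  ⟨TrianglePacking.integralityGap_eq_two, TrianglePacking.invarianceRatio_eq_two,
    TrianglePacking.wl2Equiv_shrikhande_rook, TrianglePacking.rho_shrikhande,
    TrianglePacking.rho_rook⟩
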